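/- Consider anisotropic bond percolation on the square lattice $\mathbb{Z}^2$ (edges join points at $\ell^1$-distance one): all edges are independent, each horizontal edge is open with probability $p_h$ and each vertical edge is open with probability $p_v$, where $p_h,p_v\in(0,1)$, and closed otherwise. Write $\mathbf p=(p_h,p_v)$, $\lambda_h=\frac{1-p_h}{p_h}$ and $\lambda_v=\frac{1-p_v}{p_v}$. An open cluster is a connected subgraph $A=(V_A,E_A)$ of the lattice such that every edge in $E_A$ is open and every lattice edge with exactly one endpoint in $V_A$ is closed. For $x,y\in\mathbb{Z}^2$ let $$\tau^f_{\mathbf p}(x,y)=\mathbb{P}_{\mathbf p}\bigl(\text{there is an open cluster } A \text{ with } x,y\in V_A \text{ and } |E_A|<\infty\bigr)$$ be the truncated connectivity. Theorem. For all real $\rho>1$ and $\eta\in(0,1)$ there is $p^*=p^*(\eta,\rho)\in(0,1)$ such that, for all $p_h\in(p^*,1)$, with $p_v$ determined by $\lambda_v/\lambda_h=\eta$, and for all $x=(x_1,x_2)\in\mathbb{Z}^2$ with $x_1,x_2>0$ and $x_2=\rho x_1$, $$\tau^f_{\mathbf p}(0,x)>\tau^f_{\mathbf p}(0,x'),\qquad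 x'=(x_2,x_1).$$ -/

import Mathlib

open MeasureTheory ProbabilityTheory unitInterval

noncomputable section

namespace AnisotropicPercolation

/-- The square lattice: vertices `ℤ × ℤ`, edges between points at `ℓ¹`-distance one. -/
def squareLattice : SimpleGraph (ℤ × ℤ) where
  Adj x y := |x.1 - y.1| + |x.2 - y.2| = 1
  symm := ⟨fun x y h => by rw [abs_sub_comm y.1 x.1, abs_sub_comm y.2 x.2]; exact h⟩
  loopless := ⟨fun x h => by simp at h⟩

/-- The edges of the square lattice. -/
abbrev Edge : Type := squareLattice.edgeSet

/-- An edge is horizontal if its endpoints have the same second coordinate. (Every other edge of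
the lattice is vertical.) -/
def IsHorizontal (e : Edge) : Prop :=
  ∀ x ∈ e.1, ∀ y ∈ e.1, x.2 = y.2

/-- Configurations: `ω e = true` means that `e` is open, `ω e = false` that it is closed. -/
abbrev Config : Type := Edge → Bool

open Classical in
/-- The law of the state of a single edge: open with probability `ph` if it is horizontal and with
probability `pv` if it is vertical. -/
def edgeLaw (ph pv : I) (e : Edge) : Measure Bool :=
  bernoulliMeasure true false (if IsHorizontal e then ph else pv)

instance (ph pv : I) (e : Edge) : IsProbabilityMeasure (edgeLaw ph pv e) := by
  unfold edgeLaw; infer_instance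

/-- Anisotropic bond percolation: the product over all edges of the single-edge laws. -/
def percolation (ph pv : I) : Measure Config :=
  Measure.infinitePi (edgeLaw ph pv)

/-- The edge boundary of a set of vertices: the edges with exactly one endpoint in the set. -/
def edgeBoundary (V : Set (ℤ × ℤ)) : Set Edge :=
  {e | ∃! v : ℤ × ℤ, v ∈ e.1 ∧ v ∈ V}

/-- An open cluster of `ω`: a connected subgraph of the lattice all of whose edges are open and
whose edge boundary is closed. -/
structure IsOpenCluster (ω : Config) (A : squareLattice.Subgraph) : Prop where
  connected : A.Connected
  isOpen_edges : ∀ e : Edge, e.1 ∈ A.edgeSet → ω e = true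
  closed_boundary : ∀ e ∈ edgeBoundary A.verts, ω e = false

/-- The event that `x` and `y` belong to the same finite open cluster. -/
def finiteConnection (x y : ℤ × ℤ) : Set Config :=
  {ω | ∃ A : squareLattice.Subgraph,
    IsOpenCluster ω A ∧ x ∈ A.verts ∧ y ∈ A.verts ∧ A.edgeSet.Finite}

/-- The truncated two-point connectivity. -/
def truncatedConnectivity (ph pv : I) (x y : ℤ × ℤ) : ℝ :=
  (percolation ph pv).real (finiteConnection x y)

/-- The ratio `(1 - p) / p`. -/
def odds (p : I) : ℝ := (1 - (p : ℝ)) / (p : ℝ)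

end AnisotropicPercolation

end

noncomputable section

namespace AnisotropicPercolation

open Relation

/-! ### Darts and boundary walks -/

/-! The comparison is a Peierls argument in which most contours gain under reflection in the
diagonal. Write `a = 1 - ph` and `b = 1 - pv`, so that `b ≤ a`. Filling the holes of a finite
cluster gives a region `W` whose boundary edges are all closed; this costs `a ^ H * b ^ U`, where
`H` and `U` count the horizontal and vertical boundary edges. Reflection exchanges `H` and `U`, so a
union bound estimates the connectivity to `x'` by the sum of `a ^ U * b ^ H` over regions `W`
containing `0` and `x`.

For a matching lower bound at `x`, one also asks that some inner edges (at most four per boundary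
edge) be open, so that all inner boundary vertices and `x` are joined to `0`. These events are
disjoint for distinct regions (`subset_of_mem_isolated`), and each costs at most an additional
factor `ph ^ (4 * (H + U))`.

If `H - U` is at least a fixed fraction `1 / M` of the perimeter, then `(b / a) ^ (H - U)`, with `b
/ a` close to `η`, absorbs this factor and leaves `θ < 1` (`reflected_weight_le`). Otherwise, since
`x₂ = ρ x₁` with `ρ > 1`, the perimeter exceeds that of the box spanned by `0` and `x` by a positive
fraction (`excess_of_no_surplus`). For small `a` such regions sum to a small multiple of the box
weight, hence of the connectivity to `x` (`weight_le_of_excess`, `minimal_weight_ge`).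

The Peierls count needs the boundary of a region to be one closed walk (`IsRegion.eq_boundary`); the
connection through the open inner edges uses the same fact. -/

/-- The four unit vectors of the lattice, in counterclockwise order. -/
def vec : Fin 4 → ℤ × ℤ := ![(1, 0), (0, 1), (-1, 0), (0, -1)]

/-- A dart is a vertex together with a direction. -/
abbrev Dart : Type := (ℤ × ℤ) × Fin 4

@[simp] lemma vec_zero : vec 0 = (1, 0) := rfl
@[simp] lemma vec_one : vec 1 = (0, 1) := rfl
@[simp] lemma vec_two : vec 2 = (-1, 0) := rfl
@[simp] lemma vec_three : vec 3 = (0, -1) := rfl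

lemma vec_add_two (d : Fin 4) : vec (d + 2) = -vec d := by fin_cases d <;> rfl

lemma add_vec_add_vec (u : ℤ × ℤ) (d : Fin 4) : u + vec d + vec (d + 2) = u := by
  rw [vec_add_two]; abel

lemma adj_add_vec (u : ℤ × ℤ) (d : Fin 4) : squareLattice.Adj u (u + vec d) := by
  fin_cases d <;> simp [squareLattice]

lemma exists_vec_of_adj {u v : ℤ × ℤ} (h : squareLattice.Adj u v) : ∃ d, v = u + vec d := by
  obtain ⟨a, b⟩ := u
  obtain ⟨c, e⟩ := v
  simp only [squareLattice] at h
  have key : (c = a + 1 ∧ e = b) ∨ (c = a ∧ e = b + 1) ∨ (c = a - 1 ∧ e = b) ∨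
      (c = a ∧ e = b - 1) := by
    rcases abs_cases (a - c) with h1 | h1 <;> rcases abs_cases (b - e) with h2 | h2 <;> omega
  rcases key with ⟨rfl, rfl⟩ | ⟨rfl, rfl⟩ | ⟨rfl, rfl⟩ | ⟨rfl, rfl⟩
  · exact ⟨0, by simp⟩
  · exact ⟨1, by simp⟩
  · exact ⟨2, by simp [sub_eq_add_neg]⟩
  · exact ⟨3, by simp [sub_eq_add_neg]⟩

/-- Lattice steps between two vertices of `S`. -/
def Step (S : Set (ℤ × ℤ)) (u v : ℤ × ℤ) : Prop := squareLattice.Adj u v ∧ u ∈ S ∧ v ∈ S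

lemma Step.symm {S : Set (ℤ × ℤ)} {u v : ℤ × ℤ} (h : Step S u v) : Step S v u :=
  ⟨h.1.symm, h.2.2, h.2.1⟩

/-- A finite connected region containing the origin and without holes. -/
structure IsRegion (W : Finset (ℤ × ℤ)) : Prop where
  zero_mem : (0 : ℤ × ℤ) ∈ W
  connected : ∀ z ∈ W, ReflTransGen (Step W) 0 z
  escape : ∀ z ∉ W, ∀ N : ℤ, ∃ z', N ≤ z'.1 ∧ ReflTransGen (Step (W : Set (ℤ × ℤ))ᶜ) z z'

/-- The darts which leave `W`. -/
def boundary (W : Finset (ℤ × ℤ)) : Finset Dart :=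
  (W ×ˢ Finset.univ).filter fun e => e.1 + vec e.2 ∉ W

@[simp] lemma mem_boundary {W : Finset (ℤ × ℤ)} {v : ℤ × ℤ} {d : Fin 4} :
    (v, d) ∈ boundary W ↔ v ∈ W ∧ v + vec d ∉ W := by
  simp [boundary]

/-- The three possible moves of a walk that follows a boundary, keeping the region on its left. -/
def turn (c : Fin 3) (e : Dart) : Dart :=
  match c with
  | 0 => (e.1, e.2 + 1)
  | 1 => (e.1 + vec (e.2 + 1), e.2)
  | 2 => (e.1 + vec (e.2 + 1) + vec e.2, e.2 + 3)

/-- The move of the boundary walk of `W` at the dart `e`. -/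
def turnCode (W : Finset (ℤ × ℤ)) (e : Dart) : Fin 3 :=
  if e.1 + vec (e.2 + 1) ∉ W then 0 else if e.1 + vec (e.2 + 1) + vec e.2 ∉ W then 1 else 2

/-- The successor of a dart in the boundary walk of `W`. -/
def next (W : Finset (ℤ × ℤ)) (e : Dart) : Dart := turn (turnCode W e) e

/-- The predecessor of a dart in the boundary walk of `W`. -/
def prev (W : Finset (ℤ × ℤ)) (e : Dart) : Dart :=
  if e.1 + vec (e.2 + 3) ∉ W then (e.1, e.2 + 3)
  else if e.1 + vec (e.2 + 3) + vec e.2 ∉ W then (e.1 + vec (e.2 + 3), e.2)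
  else (e.1 + vec (e.2 + 3) + vec e.2, e.2 + 1)

lemma next_mem {W : Finset (ℤ × ℤ)} {e : Dart} (he : e ∈ boundary W) :
    next W e ∈ boundary W := by
  obtain ⟨v, d⟩ := e
  rw [mem_boundary] at he
  unfold next turnCode
  by_cases h1 : v + vec (d + 1) ∈ W
  · by_cases h2 : v + vec (d + 1) + vec d ∈ W
    · simp only [h1, h2, not_true_eq_false, if_false, turn, mem_boundary, true_and]
      have h3 := vec_add_two (d + 1)
      rw [show d + 1 + 2 = d + 3 by fin_cases d <;> rfl] at h3
      rw [h3, show v + vec (d + 1) + vec d + -vec (d + 1) = v + vec d by abel]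
      exact he.2
    · simp [h1, h2, turn]
  · simp [h1, he.1, turn]

/-- This makes the walk injective on a finite set, so that every dart lies on a cycle. -/
lemma prev_next {W : Finset (ℤ × ℤ)} {e : Dart} (he : e ∈ boundary W) :
    prev W (next W e) = e := by
  obtain ⟨⟨a, b⟩, d⟩ := e
  rw [mem_boundary] at he
  unfold next turnCode
  split_ifs with h1 h2 <;> fin_cases d <;> simp_all [turn, prev]

lemma next_injOn (W : Finset (ℤ × ℤ)) : Set.InjOn (next W) (boundary W) := fun e he e' he' h => by
  rw [← prev_next he, h, prev_next he']

/-- The boundary walk as a self-map of the boundary. -/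
def nextBoundary (W : Finset (ℤ × ℤ)) (e : boundary W) : boundary W := ⟨next W e, next_mem e.2⟩

lemma coe_iterate_nextBoundary (W : Finset (ℤ × ℤ)) (e : boundary W) (k : ℕ) :
    (((nextBoundary W)^[k] e : boundary W) : Dart) = (next W)^[k] e := by
  induction k with
  | zero => rfl
  | succ k ih => rw [Function.iterate_succ_apply', Function.iterate_succ_apply', ← ih]; rfl

lemma nextBoundary_injective (W : Finset (ℤ × ℤ)) : Function.Injective (nextBoundary W) :=
  fun e e' h => Subtype.ext (next_injOn W e.2 e'.2 (congrArg Subtype.val h))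

/-! ### A height function showing that the boundary is a single cycle. -/

section Flow

variable {W : Finset (ℤ × ℤ)} {T : Finset Dart}

/-- The signed number of darts of `T` between `v` and its neighbour in direction `d`. -/
def flow (T : Finset Dart) (v : ℤ × ℤ) (d : Fin 4) : ℤ :=
  (if (v, d) ∈ T then 1 else 0) - (if (v + vec d, d + 2) ∈ T then 1 else 0)

lemma flow_neg (T : Finset Dart) (v : ℤ × ℤ) (d : Fin 4) :
    flow T (v + vec d) (d + 2) = -flow T v d := by
  unfold flow
  rw [add_vec_add_vec, show d + 2 + 2 = d by fin_cases d <;> rfl]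
  ring

lemma flow_eq_zero (hT : T ⊆ boundary W) {v : ℤ × ℤ} {d : Fin 4} (h : v ∈ W ↔ v + vec d ∈ W) :
    flow T v d = 0 := by
  have h1 : (v, d) ∉ T := fun h' => by
    have := mem_boundary.1 (hT h'); tauto
  have h2 : (v + vec d, d + 2) ∉ T := fun h' => by
    have := mem_boundary.1 (hT h')
    rw [add_vec_add_vec] at this; tauto
  simp [flow, h1, h2]

lemma flow_of_mem_boundary (hT : T ⊆ boundary W) {v : ℤ × ℤ} {d : Fin 4}
    (h : (v, d) ∈ boundary W) : flow T v d = if (v, d) ∈ T then 1 else 0 := by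
  have h2 : (v + vec d, d + 2) ∉ T := fun h' => by
    have := mem_boundary.1 (hT h')
    have := mem_boundary.1 h
    tauto
  simp [flow, h2]

/-- One move of the walk joins two sides of the same unit square, so a `next`-invariant set enters
each square as often as it leaves it. The proof checks the sixteen patterns of corners in `W`. -/
lemma flow_plaquette (hT : T ⊆ boundary W) (hnext : ∀ e ∈ boundary W, next W e ∈ T ↔ e ∈ T)
    (a b : ℤ) : flow T (a, b) 0 + flow T (a + 1, b) 1 = flow T (a, b) 1 + flow T (a, b + 1) 0 := by
  have m : ∀ v d, (v, d) ∈ T → v ∈ W ∧ v + vec d ∉ W := fun v d h => mem_boundary.1 (hT h)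
  have n0 := hnext ((a, b), 0)
  have n1 := hnext ((a + 1, b), 1)
  have n2 := hnext ((a + 1, b + 1), 2)
  have n3 := hnext ((a, b + 1), 3)
  have m0 := m (a, b) 0
  have m1 := m (a + 1, b) 1
  have m2 := m (a + 1, b + 1) 2
  have m3 := m (a, b + 1) 3
  have m4 := m (a, b) 1
  have m5 := m (a + 1, b) 2
  have m6 := m (a + 1, b + 1) 3
  have m7 := m (a, b + 1) 0
  have e1 : (2 : Fin 4) + 1 = 3 := rfl
  have e2 : (3 : Fin 4) + 1 = 0 := rfl
  have e3 : (1 : Fin 4) + 1 = 2 := rfl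
  have e4 : (1 : Fin 4) + 3 = 0 := rfl
  have e5 : (2 : Fin 4) + 3 = 1 := rfl
  have e6 : (3 : Fin 4) + 3 = 2 := rfl
  have e7 : (1 : Fin 4) + 2 = 3 := rfl
  simp only [mem_boundary, next, turnCode, e1, e2, e3, zero_add, vec_zero, vec_one,
    vec_two, vec_three, Prod.mk_add_mk, add_zero, add_neg_cancel_right] at n0 n1 n2 n3 m0 m1 m2 m3 m4 m5 m6 m7
  simp only [flow, e7, zero_add, vec_zero, vec_one, Prod.mk_add_mk, add_zero]
  clear hT hnext m
  by_cases p0 : (a, b) ∈ W <;> by_cases p1 : (a + 1, b) ∈ W <;>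
    by_cases p2 : (a + 1, b + 1) ∈ W <;> by_cases p3 : (a, b + 1) ∈ W <;>
    simp only [p0, p1, p2, p3, turn, e1, e2, e3, e4, e5, e6, zero_add, not_true_eq_false,
      not_false_eq_true, if_true, if_false, and_true, and_false, and_self, true_imp_iff,
      false_imp_iff, imp_false, vec_zero, vec_one, vec_two, vec_three, Prod.mk_add_mk, add_zero,
      add_neg_cancel_right] at n0 n1 n2 n3 m0 m1 m2 m3 m4 m5 m6 m7 <;>
    simp_all

/-- The signed number of darts of `T` on the ray to the east of `v`, up to the abscissa `B`. -/
def height (T : Finset Dart) (B : ℤ) (v : ℤ × ℤ) : ℤ :=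
  ∑ i ∈ Finset.Ico v.1 B, flow T (i, v.2) 0

variable {B : ℤ}

lemma height_eq_zero (T : Finset Dart) {v : ℤ × ℤ} (h : B ≤ v.1) : height T B v = 0 := by
  simp [height, Finset.Ico_eq_empty_of_le h]

lemma height_sub_zero (hT : T ⊆ boundary W) (hB : ∀ z ∈ W, z.1 < B) (v : ℤ × ℤ) :
    height T B v - height T B (v + vec 0) = flow T v 0 := by
  rcases lt_or_ge v.1 B with h | h
  · unfold height
    rw [← Finset.insert_Ico_add_one_left_eq_Ico h, Finset.sum_insert (by simp)]
    simp
  · rw [height_eq_zero T h, height_eq_zero T (by simp; omega), flow_eq_zero hT]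
    · simp
    · have h1 : v ∉ W := fun h' => by have := hB _ h'; omega
      have h2 : v + vec 0 ∉ W := fun h' => by have := hB _ h'; simp at this; omega
      tauto

/-- East of `W` everything vanishes; `flow_plaquette` then carries the identity westward, one square
at a time. -/
lemma height_sub_one (hT : T ⊆ boundary W) (hnext : ∀ e ∈ boundary W, next W e ∈ T ↔ e ∈ T)
    (hB : ∀ z ∈ W, z.1 < B) (v : ℤ × ℤ) :
    height T B v - height T B (v + vec 1) = flow T v 1 := by
  obtain ⟨a, b⟩ := v
  have base : ∀ a, B ≤ a → height T B (a, b) - height T B ((a, b) + vec 1) = flow T (a, b) 1 := by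
    intro a h
    rw [height_eq_zero T h, height_eq_zero T (by simp; omega), flow_eq_zero hT]
    · simp
    · have h1 : (a, b) ∉ W := fun h' => by have := hB _ h'; simp at this; omega
      have h2 : (a, b) + vec 1 ∉ W := fun h' => by have := hB _ h'; simp at this; omega
      tauto
  rcases le_total B a with h | h
  · exact base a h
  · induction a, h using Int.leInductionDown with
    | base => exact base B le_rfl
    | pred a _ ih =>
      have h1 := height_sub_zero hT hB (a - 1, b)
      have h2 := height_sub_zero hT hB (a - 1, b + 1)
      have h3 := flow_plaquette hT hnext (a - 1) b
      simp only [vec_zero, vec_one, Prod.mk_add_mk, sub_add_cancel, add_zero] at *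
      linarith

lemma height_sub (hT : T ⊆ boundary W) (hnext : ∀ e ∈ boundary W, next W e ∈ T ↔ e ∈ T)
    (hB : ∀ z ∈ W, z.1 < B) (v : ℤ × ℤ) (d : Fin 4) :
    height T B v - height T B (v + vec d) = flow T v d := by
  have opp : ∀ d, (∀ v, height T B v - height T B (v + vec d) = flow T v d) →
      ∀ v, height T B v - height T B (v + vec (d + 2)) = flow T v (d + 2) := by
    intro d h v
    have h1 := h (v + vec (d + 2))
    have h2 := flow_neg T v (d + 2)
    have h3 := add_vec_add_vec v (d + 2)
    rw [show d + 2 + 2 = d by fin_cases d <;> rfl] at h2 h3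
    rw [h3] at h1
    linarith
  fin_cases d
  · exact height_sub_zero hT hB v
  · exact height_sub_one hT hnext hB v
  · exact opp 0 (height_sub_zero hT hB) v
  · exact opp 1 (height_sub_one hT hnext hB) v

/-- The boundary of a region is a single closed walk. -/
lemma IsRegion.eq_boundary (hW : IsRegion W) (hT : T ⊆ boundary W) (hne : T.Nonempty)
    (hnext : ∀ e ∈ boundary W, next W e ∈ T ↔ e ∈ T) : T = boundary W := by
  obtain ⟨B, hB⟩ : ∃ B : ℤ, ∀ z ∈ W, z.1 < B := by
    obtain ⟨M, hM⟩ := (W.image Prod.fst).bddAbove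
    exact ⟨M + 1, fun z hz => Int.lt_add_one_of_le (hM (by simpa using ⟨z.2, hz⟩))⟩
  have hs := height_sub hT hnext hB
  have const : ∀ {S : Set (ℤ × ℤ)}, (∀ u v, u ∈ S → v ∈ S → (u ∈ W ↔ v ∈ W)) →
      ∀ {u v}, ReflTransGen (Step S) u v → height T B u = height T B v := by
    intro S hS u v h
    induction h with
    | refl => rfl
    | tail _ h ih =>
      obtain ⟨d, rfl⟩ := exists_vec_of_adj h.1
      rw [ih]
      have := hs _ d ▸ flow_eq_zero hT (hS _ _ h.2.1 h.2.2)
      linarith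
  have out : ∀ z ∉ W, height T B z = 0 := by
    intro z hz
    obtain ⟨z', h1, h2⟩ := hW.escape z hz B
    rw [const (fun u v hu hv => iff_of_false hu hv) h2, height_eq_zero T h1]
  have inn : ∀ z ∈ W, height T B z = height T B 0 := fun z hz =>
    (const (fun u v hu hv => iff_of_true hu hv) (hW.connected z hz)).symm
  -- Across each boundary dart the height drops from its constant value on `W` to `0`. Hence either
  -- all darts belong to `T` or none does.
  have key : ∀ e ∈ boundary W, height T B 0 = if e ∈ T then 1 else 0 := by
    rintro ⟨v, d⟩ he
    have h := hs v d
    have h' := mem_boundary.1 he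
    rw [flow_of_mem_boundary hT he, inn _ h'.1, out _ h'.2, sub_zero] at h
    exact h
  obtain ⟨e, he⟩ := hne
  have h0 : height T B 0 = 1 := by rw [key e (hT he), if_pos he]
  refine hT.antisymm fun e' he' => ?_
  have := key e' he'
  by_contra hn
  simp [h0, hn] at this

end Flow

lemma IsRegion.exists_iterate {W : Finset (ℤ × ℤ)} (hW : IsRegion W) {e₀ e : Dart}
    (he₀ : e₀ ∈ boundary W) (he : e ∈ boundary W) :
    ∃ k < (boundary W).card, (next W)^[k] e₀ = e := by
  classical
  set f := nextBoundary W
  set x : boundary W := ⟨e₀, he₀⟩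
  have hfix : f^[Function.minimalPeriod f x] x = x := Function.isPeriodicPt_minimalPeriod f x
  have hpos : 0 < Function.minimalPeriod f x :=
    Function.minimalPeriod_pos_of_mem_periodicPts
      ((nextBoundary_injective W).mem_periodicPts x)
  set T : Finset Dart :=
    (boundary W).filter fun e => ∃ k, (next W)^[k] e₀ = e
  have hT : T = boundary W := by
    refine hW.eq_boundary (Finset.filter_subset _ _) ⟨e₀, by simp [T, he₀]; exact ⟨0, rfl⟩⟩ ?_
    intro e he
    simp only [T, Finset.mem_filter, next_mem he, he, true_and]
    constructor
    · rintro ⟨k, hk⟩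
      -- Adding a full period allows a step backwards even when `k = 0`.
      obtain ⟨m, hm⟩ : ∃ m, k + Function.minimalPeriod f x = m + 1 := ⟨_, (Nat.succ_pred_eq_of_pos
        (by omega)).symm⟩
      refine ⟨m, next_injOn W ?_ he ?_⟩
      · have := coe_iterate_nextBoundary W x m
        change _ = (next W)^[m] e₀ at this
        rw [← this]; exact Subtype.coe_prop _
      · rw [← Function.iterate_succ_apply' (next W) m e₀, ← Nat.add_one, ← hm, Function.iterate_add_apply, ← hk]
        congr 1
        rw [← coe_iterate_nextBoundary W x, hfix]
    · rintro ⟨k, hk⟩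
      exact ⟨k + 1, by rw [Function.iterate_succ_apply', hk]⟩
  rw [← hT] at he
  obtain ⟨-, k, rfl⟩ := Finset.mem_filter.1 he
  refine ⟨k % Function.minimalPeriod f x, (Nat.mod_lt _ hpos).trans_le ?_, ?_⟩
  · have := Function.minimalPeriod_le_card (f := f) (x := x)
    simpa using this
  · rw [← coe_iterate_nextBoundary W x, ← coe_iterate_nextBoundary W x,
      Function.iterate_mod_minimalPeriod_eq]

open scoped ENNReal

/-! ### Geometry of regions -/

lemma Step.mono {S T : Set (ℤ × ℤ)} (h : S ⊆ T) {u v : ℤ × ℤ} (huv : Step S u v) : Step T u v :=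
  ⟨huv.1, h huv.2.1, h huv.2.2⟩

lemma path_symm {S : Set (ℤ × ℤ)} {u v : ℤ × ℤ} (h : ReflTransGen (Step S) u v) :
    ReflTransGen (Step S) v u := by
  induction h with
  | refl => exact .refl
  | tail _ h ih => exact .head h.symm ih

lemma path_mono {S T : Set (ℤ × ℤ)} (h : S ⊆ T) {u v : ℤ × ℤ} (huv : ReflTransGen (Step S) u v) :
    ReflTransGen (Step T) u v :=
  ReflTransGen.mono (fun _ _ h' => h'.mono h) _ _ huv

lemma path_end_mem {S : Set (ℤ × ℤ)} {u v : ℤ × ℤ} (hu : u ∈ S)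
    (h : ReflTransGen (Step S) u v) : v ∈ S := by
  cases h with
  | refl => exact hu
  | tail _ h => exact h.2.2

lemma path_ray {S : Set (ℤ × ℤ)} {z : ℤ × ℤ} {d : Fin 4} {n : ℕ}
    (h : ∀ i ≤ n, z + i • vec d ∈ S) : ReflTransGen (Step S) z (z + n • vec d) := by
  induction n with
  | zero => simpa using ReflTransGen.refl
  | succ n ih =>
    refine .tail (ih fun i hi => h i (by omega)) ⟨?_, h n (by omega), h (n + 1) le_rfl⟩
    rw [succ_nsmul, ← add_assoc]
    exact adj_add_vec _ _

lemma exists_ray {W : Finset (ℤ × ℤ)} {z : ℤ × ℤ} (hz : z ∈ W) (d : Fin 4) :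
    ∃ n : ℕ, (∀ i ≤ n, z + i • vec d ∈ W) ∧ (z + n • vec d, d) ∈ boundary W := by
  have hex : ∃ n : ℕ, z + n • vec d ∉ W := by
    by_contra! h
    have hinj : Function.Injective fun n : ℕ => z + n • vec d := by
      intro m n hmn
      simp only [add_right_inj] at hmn
      have h1 := congrArg Prod.fst hmn
      have h2 := congrArg Prod.snd hmn
      fin_cases d <;> simp at h1 h2 <;> assumption
    exact Set.infinite_of_injective_forall_mem hinj h W.finite_toSet
  classical
  obtain ⟨n, hn⟩ : ∃ n, Nat.find hex = n + 1 := by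
    refine ⟨Nat.find hex - 1, (Nat.succ_pred_eq_of_pos (Nat.pos_of_ne_zero fun h0 => ?_)).symm⟩
    have := Nat.find_spec hex
    rw [h0] at this
    exact this (by simpa using hz)
  have hin : ∀ i ≤ n, z + i • vec d ∈ W := fun i hi =>
    not_not.1 (Nat.find_min hex (show i < Nat.find hex by omega))
  refine ⟨n, hin, mem_boundary.2 ⟨hin n le_rfl, ?_⟩⟩
  have := Nat.find_spec hex
  rwa [hn, succ_nsmul, ← add_assoc] at this

/-- The number of horizontal edges in the boundary of `W`. -/
def horizontalPerimeter (W : Finset (ℤ × ℤ)) : ℕ :=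
  ((boundary W).filter fun e => e.2 = 0 ∨ e.2 = 2).card

/-- The number of vertical edges in the boundary of `W`. -/
def verticalPerimeter (W : Finset (ℤ × ℤ)) : ℕ :=
  ((boundary W).filter fun e => ¬(e.2 = 0 ∨ e.2 = 2)).card

lemma horizontalPerimeter_add_verticalPerimeter (W : Finset (ℤ × ℤ)) :
    horizontalPerimeter W + verticalPerimeter W = (boundary W).card :=
  Finset.card_filter_add_card_filter_not _

/-- Going north from each of the `n + 1` points of the segment yields a boundary dart in a column of
its own. -/
lemma east_extent_lt {W : Finset (ℤ × ℤ)} {z : ℤ × ℤ} {n : ℕ}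
    (h : ∀ i ≤ n, z + i • vec 0 ∈ W) : n < (boundary W).card := by
  have hs : Set.SurjOn (fun e : Dart => e.1.1) (boundary W)
      ((Finset.range (n + 1)).image fun i : ℕ => z.1 + i : Finset ℤ) := by
    intro j hj
    simp only [Finset.coe_image, Set.mem_image, Finset.mem_coe, Finset.mem_range] at hj
    obtain ⟨i, hi, rfl⟩ := hj
    obtain ⟨m, -, hm⟩ := exists_ray (h i (by omega)) 1
    exact ⟨_, hm, by simp⟩
  have := Finset.card_le_card_of_surjOn _ hs
  rw [Finset.card_image_of_injective _ (fun a b hab => by simpa using hab)] at this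
  simpa using this

/-- A discrete intermediate value theorem: one step changes the ordinate by at most one. -/
lemma exists_mem_row {W : Finset (ℤ × ℤ)} {z : ℤ × ℤ} (h0 : (0 : ℤ × ℤ) ∈ W)
    (hz : ReflTransGen (Step (W : Set (ℤ × ℤ))) 0 z) {j : ℤ} (hj : 0 ≤ j) (hjz : j ≤ z.2) :
    ∃ w ∈ W, w.2 = j := by
  induction hz with
  | refl => exact ⟨0, h0, by simp at hjz ⊢; omega⟩
  | @tail u v _ h ih =>
    by_cases hu : j ≤ u.2
    · exact ih hu
    · refine ⟨v, h.2.2, ?_⟩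
      obtain ⟨d, rfl⟩ := exists_vec_of_adj h.1
      fin_cases d <;> simp at hjz ⊢ <;> omega

/-- Every row between `0` and `z` meets `W` and is left by it both to the east and to the west. -/
lemma IsRegion.le_horizontalPerimeter {W : Finset (ℤ × ℤ)} (hW : IsRegion W) {z : ℤ × ℤ}
    (hz : z ∈ W) (hz2 : 0 ≤ z.2) : 2 * (z.2 + 1) ≤ horizontalPerimeter W := by
  have hs : Set.SurjOn (fun e : Dart => (e.1.2, e.2))
      ((boundary W).filter fun e => e.2 = 0 ∨ e.2 = 2 : Finset Dart)
      (Finset.Icc 0 z.2 ×ˢ {0, 2} : Finset (ℤ × Fin 4)) := by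
    rintro ⟨j, d⟩ hj
    simp only [Finset.coe_product, Set.mem_prod, Finset.mem_coe, Finset.mem_Icc,
      Finset.mem_insert, Finset.mem_singleton] at hj
    obtain ⟨w, hw, rfl⟩ := exists_mem_row hW.zero_mem (hW.connected z hz) hj.1.1 hj.1.2
    obtain ⟨m, -, hm⟩ := exists_ray hw d
    refine ⟨_, Finset.mem_coe.2 (Finset.mem_filter.2 ⟨hm, hj.2⟩), ?_⟩
    rcases hj.2 with rfl | rfl <;> simp
  have h := Finset.card_le_card_of_surjOn _ hs
  rw [Finset.card_product, Int.card_Icc, Finset.card_pair (by decide)] at h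
  unfold horizontalPerimeter
  omega

/-! ### Reflection in the diagonal -/

/-- The reflection of a set of vertices in the diagonal. -/
def reflect (W : Finset (ℤ × ℤ)) : Finset (ℤ × ℤ) := W.image Prod.swap

@[simp] lemma mem_reflect {W : Finset (ℤ × ℤ)} {z : ℤ × ℤ} : z ∈ reflect W ↔ z.swap ∈ W := by
  simp only [reflect, Finset.mem_image]
  exact ⟨by rintro ⟨a, ha, rfl⟩; simpa using ha, fun h => ⟨_, h, Prod.swap_swap z⟩⟩

@[simp] lemma reflect_reflect (W : Finset (ℤ × ℤ)) : reflect (reflect W) = W := by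
  ext z; simp

/-- The reflection of a direction in the diagonal. -/
def reflectDir : Fin 4 → Fin 4 := ![1, 0, 3, 2]

lemma reflectDir_reflectDir (d : Fin 4) : reflectDir (reflectDir d) = d := by
  fin_cases d <;> rfl

lemma swap_add_vec (u : ℤ × ℤ) (d : Fin 4) :
    (u + vec d).swap = u.swap + vec (reflectDir d) := by
  fin_cases d <;> simp [reflectDir]

lemma step_swap {S T : Set (ℤ × ℤ)} (h : ∀ z ∈ S, z.swap ∈ T) {u v : ℤ × ℤ} (huv : Step S u v) :
    Step T u.swap v.swap := by
  obtain ⟨d, rfl⟩ := exists_vec_of_adj huv.1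
  refine ⟨?_, h _ huv.2.1, h _ huv.2.2⟩
  rw [swap_add_vec]
  exact adj_add_vec _ _

lemma path_swap {S T : Set (ℤ × ℤ)} (h : ∀ z ∈ S, z.swap ∈ T) {u v : ℤ × ℤ}
    (huv : ReflTransGen (Step S) u v) : ReflTransGen (Step T) u.swap v.swap :=
  ReflTransGen.lift Prod.swap (fun _ _ => step_swap h) _ _ huv

lemma horizontalPerimeter_reflect (W : Finset (ℤ × ℤ)) :
    horizontalPerimeter (reflect W) = verticalPerimeter W := by
  unfold horizontalPerimeter verticalPerimeter
  refine Finset.card_nbij' (fun e => (e.1.swap, reflectDir e.2))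
    (fun e => (e.1.swap, reflectDir e.2)) ?_ ?_ ?_ ?_
  · rintro ⟨v, d⟩ h
    simp only [Finset.coe_filter, Set.mem_ofPred_eq, mem_boundary, mem_reflect, swap_add_vec] at h ⊢
    refine ⟨h.1, ?_⟩
    rcases h.2 with rfl | rfl <;> decide
  · rintro ⟨v, d⟩ h
    simp only [Finset.coe_filter, Set.mem_ofPred_eq, mem_boundary, mem_reflect, swap_add_vec,
      Prod.swap_swap, reflectDir_reflectDir] at h ⊢
    refine ⟨h.1, ?_⟩
    have := h.2
    fin_cases d <;> simp [reflectDir] at this ⊢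
  · rintro ⟨v, d⟩ _; simp [reflectDir_reflectDir]
  · rintro ⟨v, d⟩ _; simp [reflectDir_reflectDir]

lemma verticalPerimeter_reflect (W : Finset (ℤ × ℤ)) :
    verticalPerimeter (reflect W) = horizontalPerimeter W := by
  rw [← horizontalPerimeter_reflect, reflect_reflect]

lemma IsRegion.reflect {W : Finset (ℤ × ℤ)} (hW : IsRegion W) :
    IsRegion (AnisotropicPercolation.reflect W) where
  zero_mem := by simpa using hW.zero_mem
  connected z hz := by
    have := path_swap (T := (AnisotropicPercolation.reflect W : Finset (ℤ × ℤ)))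
      (fun u hu => by simpa using hu) (hW.connected _ (mem_reflect.1 hz))
    simpa using this
  escape z hz N := by
    obtain ⟨M, hM⟩ := (W.image Prod.fst).bddAbove
    rw [mem_reflect] at hz
    obtain ⟨z', h1, h2⟩ := hW.escape _ hz (M + 1)
    -- Escape is only postulated eastward. Once east of all of `W`, the path can turn north, and the
    -- reflection makes this an eastward escape.
    have h3 : ReflTransGen (Step (W : Set (ℤ × ℤ))ᶜ) z' (z' + (N - z'.2).toNat • vec 1) := by
      refine path_ray fun i _ hi => ?_
      have : z'.1 ≤ M := hM (Finset.mem_coe.2 (Finset.mem_image.2 ⟨_, hi, by simp⟩))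
      omega
    have h4 := path_swap
      (T := ((AnisotropicPercolation.reflect W : Finset (ℤ × ℤ)) : Set (ℤ × ℤ))ᶜ)
      (fun u hu => by simpa using hu) (h2.trans h3)
    rw [Prod.swap_swap] at h4
    refine ⟨_, ?_, h4⟩
    simp
    omega

lemma IsRegion.le_verticalPerimeter {W : Finset (ℤ × ℤ)} (hW : IsRegion W) {z : ℤ × ℤ}
    (hz : z ∈ W) (hz1 : 0 ≤ z.1) : 2 * (z.1 + 1) ≤ verticalPerimeter W := by
  rw [← horizontalPerimeter_reflect]
  exact hW.reflect.le_horizontalPerimeter (z := z.swap) (by simpa using hz) hz1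

/-! ### Boxes and filled sets -/

/-- A point outside the rectangle can go straight east, unless it lies to the west of it; it then
first goes north, past the top row. -/
lemma exists_path_east {V : Set (ℤ × ℤ)} {a b c e : ℤ}
    (hV : ∀ z ∈ V, a ≤ z.1 ∧ z.1 ≤ b ∧ c ≤ z.2 ∧ z.2 ≤ e) {z : ℤ × ℤ}
    (hz : ¬(a ≤ z.1 ∧ z.1 ≤ b ∧ c ≤ z.2 ∧ z.2 ≤ e)) (N : ℤ) :
    ∃ z', N ≤ z'.1 ∧ ReflTransGen (Step Vᶜ) z z' := by
  have east : ∀ z : ℤ × ℤ, (b < z.1 ∨ z.2 < c ∨ e < z.2) →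
      ∃ z', N ≤ z'.1 ∧ ReflTransGen (Step Vᶜ) z z' := by
    intro z hz
    refine ⟨z + (N - z.1).toNat • vec 0, by simp; omega, path_ray fun i _ hi => ?_⟩
    have := hV _ hi
    simp at this
    omega
  by_cases h : b < z.1 ∨ z.2 < c ∨ e < z.2
  · exact east z h
  · obtain ⟨z', h1, h2⟩ := east (z + (e + 1 - z.2).toNat • vec 1) (by simp; omega)
    refine ⟨z', h1, .trans (path_ray fun i _ hi => ?_) h2⟩
    have := hV _ hi
    simp at this
    omega

/-- The box with opposite corners `0` and `x`. -/
def box (x : ℤ × ℤ) : Finset (ℤ × ℤ) := Finset.Icc 0 x.1 ×ˢ Finset.Icc 0 x.2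

@[simp] lemma mem_box {x z : ℤ × ℤ} :
    z ∈ box x ↔ (0 ≤ z.1 ∧ z.1 ≤ x.1) ∧ 0 ≤ z.2 ∧ z.2 ≤ x.2 := by
  simp [box]

lemma isRegion_box {x : ℤ × ℤ} (h1 : 0 ≤ x.1) (h2 : 0 ≤ x.2) : IsRegion (box x) where
  zero_mem := by simp [h1, h2]
  connected z hz := by
    rw [mem_box] at hz
    have p1 : ReflTransGen (Step (box x : Set (ℤ × ℤ))) 0 (0 + z.1.toNat • vec 0) :=
      path_ray fun i hi => by simp; omega
    have p2 : ReflTransGen (Step (box x : Set (ℤ × ℤ))) (0 + z.1.toNat • vec 0)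
        (0 + z.1.toNat • vec 0 + z.2.toNat • vec 1) :=
      path_ray fun i hi => by simp; omega
    have h3 : (0 : ℤ × ℤ) + z.1.toNat • vec 0 + z.2.toNat • vec 1 = z := by
      ext <;> simp <;> omega
    exact h3 ▸ p1.trans p2
  escape z hz N := exists_path_east (a := 0) (b := x.1) (c := 0) (e := x.2)
    (fun z hz => by simpa [and_assoc] using hz) (by simpa [and_assoc] using hz) N

lemma horizontalPerimeter_box_le {x : ℤ × ℤ} (h2 : 0 ≤ x.2) :
    (horizontalPerimeter (box x) : ℤ) ≤ 2 * (x.2 + 1) := by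
  have h := Finset.card_le_card_of_injOn
    (s := (boundary (box x)).filter fun e => e.2 = 0 ∨ e.2 = 2)
    (t := Finset.Icc 0 x.2 ×ˢ ({0, 2} : Finset (Fin 4)))
    (fun e : Dart => (e.1.2, e.2)) ?_ ?_
  · rw [Finset.card_product, Int.card_Icc, Finset.card_pair (by decide)] at h
    unfold horizontalPerimeter
    omega
  · rintro ⟨v, d⟩ h
    simp only [Finset.coe_filter, Set.mem_ofPred_eq, mem_boundary, mem_box] at h
    simp only [Finset.coe_product, Set.mem_prod, Finset.mem_coe, Finset.mem_Icc,
      Finset.mem_insert, Finset.mem_singleton]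
    exact ⟨h.1.1.2, h.2⟩
  · rintro ⟨⟨a, b⟩, d⟩ h ⟨⟨a', b'⟩, d'⟩ h' heq
    simp only [Finset.coe_filter, Set.mem_ofPred_eq, mem_boundary, mem_box] at h h'
    simp only [Prod.mk.injEq] at heq
    obtain ⟨rfl, rfl⟩ := heq
    obtain ⟨⟨i1, i2⟩, i3⟩ := h
    obtain ⟨⟨j1, j2⟩, j3⟩ := h'
    rcases i3 with rfl | rfl <;> simp at i1 i2 j1 j2 ⊢ <;> omega

lemma verticalPerimeter_box_le {x : ℤ × ℤ} (h1 : 0 ≤ x.1) :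
    (verticalPerimeter (box x) : ℤ) ≤ 2 * (x.1 + 1) := by
  have : reflect (box x) = box x.swap := by
    ext z; simp [and_comm]
  rw [← horizontalPerimeter_reflect, this]
  exact horizontalPerimeter_box_le (x := x.swap) h1

/-- Filling the holes of a finite connected set yields a region. -/
lemma exists_isRegion_of_connected {V : Set (ℤ × ℤ)} (hV : V.Finite) (h0 : (0 : ℤ × ℤ) ∈ V)
    (hconn : ∀ z ∈ V, ReflTransGen (Step V) 0 z) :
    ∃ W : Finset (ℤ × ℤ), IsRegion W ∧ V ⊆ W ∧
      ∀ v d, (v, d) ∈ boundary W → v ∈ V ∧ v + vec d ∉ V := by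
  -- The unbounded part of the complement of `V`; the filled region consists of all other vertices.
  let Esc : ℤ × ℤ → Prop := fun z =>
    z ∉ V ∧ ∀ N : ℤ, ∃ z', N ≤ z'.1 ∧ ReflTransGen (Step Vᶜ) z z'
  have esc_path : ∀ {z u}, Esc z → ReflTransGen (Step Vᶜ) z u → Esc u := fun hz hzu =>
    ⟨path_end_mem (S := Vᶜ) hz.1 hzu, fun N => by
      obtain ⟨z', h1, h2⟩ := hz.2 N
      exact ⟨z', h1, (path_symm hzu).trans h2⟩⟩
  obtain ⟨b, hb⟩ := (hV.image Prod.fst).bddAbove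
  obtain ⟨a, ha⟩ := (hV.image Prod.fst).bddBelow
  obtain ⟨e, he⟩ := (hV.image Prod.snd).bddAbove
  obtain ⟨c, hc⟩ := (hV.image Prod.snd).bddBelow
  have hrect : ∀ z ∈ V, a ≤ z.1 ∧ z.1 ≤ b ∧ c ≤ z.2 ∧ z.2 ≤ e := fun z hz =>
    ⟨ha ⟨z, hz, rfl⟩, hb ⟨z, hz, rfl⟩, hc ⟨z, hz, rfl⟩, he ⟨z, hz, rfl⟩⟩
  have hfin : {z | ¬Esc z}.Finite := by
    refine (Finset.finite_toSet (Finset.Icc a b ×ˢ Finset.Icc c e)).subset fun z hz => ?_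
    simp only [Finset.coe_product, Set.mem_prod, Finset.mem_coe, Finset.mem_Icc]
    by_contra hn
    have hn' : ¬(a ≤ z.1 ∧ z.1 ≤ b ∧ c ≤ z.2 ∧ z.2 ≤ e) := by tauto
    exact hz ⟨fun h => hn' (hrect z h), fun N => exists_path_east hrect hn' N⟩
  have hW : ∀ z, z ∈ hfin.toFinset ↔ ¬Esc z := fun z => by simp
  generalize hfin.toFinset = W at hW
  have hVW : V ⊆ W := fun z hz => (hW z).2 fun h => h.1 hz
  refine ⟨W, ⟨hVW h0, fun z hz => ?_, fun z hz N => ?_⟩, hVW, fun v d hvd => ?_⟩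
  · by_cases hzV : z ∈ V
    · exact path_mono hVW (hconn z hzV)
    -- From a vertex in a hole the eastward ray must hit `V`, and it stays in the hole until then.
    · have hex : ∃ n : ℕ, z + n • vec 0 ∈ V := by
        by_contra! h
        exact (hW z).1 hz ⟨hzV, fun N => ⟨z + (N - z.1).toNat • vec 0, by simp; omega,
          path_ray fun i _ => h i⟩⟩
      classical
      have hn := Nat.find_spec hex
      have hlt : ∀ i < Nat.find hex, z + i • vec 0 ∉ V := fun i hi => Nat.find_min hex hi
      refine (path_mono hVW (hconn _ hn)).trans (path_symm (path_ray fun i hi => ?_))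
      rcases hi.eq_or_lt with rfl | hi
      · exact hVW hn
      · refine (hW _).2 fun h => (hW z).1 hz (esc_path h (path_symm (path_ray fun j hj => ?_)))
        exact hlt j (by omega)
  · have hz' : Esc z := by simpa using mt (hW z).2 hz
    obtain ⟨z', h1, h2⟩ := hz'.2 N
    refine ⟨z', h1, ?_⟩
    clear h1
    induction h2 with
    | refl => exact .refl
    | tail h h' ih =>
      have hu := esc_path hz' h
      exact ih.tail ⟨h'.1, fun hm => (hW _).1 hm hu,
        fun hm => (hW _).1 hm (esc_path hu (.single h'))⟩
  · rw [mem_boundary, hW, hW, not_not] at hvd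
    refine ⟨by_contra fun hv => hvd.1 (esc_path hvd.2 (.single ?_)), hvd.2.1⟩
    exact ⟨(adj_add_vec v d).symm, hvd.2.1, hv⟩

/-! ### Counting regions -/

/-- A path in `W` from `0` that left `W'` would cross a boundary dart of `W'`, hence of `W`, and so
leave `W` too. -/
lemma IsRegion.subset_of_boundary_subset {W W' : Finset (ℤ × ℤ)} (hW : IsRegion W)
    (hW' : IsRegion W') (h : boundary W' ⊆ boundary W) : W ⊆ W' := by
  intro z hz
  have := hW.connected z hz
  clear hz
  induction this with
  | refl => exact hW'.zero_mem
  | tail _ h' ih =>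
    obtain ⟨d, rfl⟩ := exists_vec_of_adj h'.1
    by_contra hn
    exact (mem_boundary.1 (h (mem_boundary.2 ⟨ih, hn⟩))).2 h'.2.2

/-- The starting dart and the turns determine the whole walk; the walk exhausts the boundary, and
the boundary determines the region. -/
lemma IsRegion.eq_of_turnCode_eq {W W' : Finset (ℤ × ℤ)} (hW : IsRegion W) (hW' : IsRegion W')
    {e : Dart} (he : e ∈ boundary W) (he' : e ∈ boundary W')
    (hcard : (boundary W).card = (boundary W').card)
    (hcode : ∀ k < (boundary W).card,
      turnCode W ((next W)^[k] e) = turnCode W' ((next W')^[k] e)) : W = W' := by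
  have hiter : ∀ k ≤ (boundary W).card, (next W)^[k] e = (next W')^[k] e := by
    intro k
    induction k with
    | zero => intro _; rfl
    | succ k ih =>
      intro hk
      have h1 := hcode k hk
      rw [Function.iterate_succ_apply', Function.iterate_succ_apply', next, next, h1,
        ih (by omega)]
  have mem : ∀ (X : Finset (ℤ × ℤ)), e ∈ boundary X → ∀ k, (next X)^[k] e ∈ boundary X := by
    intro X hX k
    induction k with
    | zero => exact hX
    | succ k ih => rw [Function.iterate_succ_apply']; exact next_mem ih
  have h1 : boundary W ⊆ boundary W' := by
    intro f hf
    obtain ⟨k, hk, rfl⟩ := hW.exists_iterate he hf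
    rw [hiter k hk.le]; exact mem W' he' k
  have h2 : boundary W' ⊆ boundary W := by
    intro f hf
    obtain ⟨k, hk, rfl⟩ := hW'.exists_iterate he' hf
    rw [← hiter k (by omega)]; exact mem W he k
  exact (hW.subset_of_boundary_subset hW' h2).antisymm (hW'.subset_of_boundary_subset hW h1)

/-- The Peierls estimate: there are at most `6 ^ n` regions with perimeter `n`. -/
lemma tsum_pow_card_boundary_le (κ : ℝ≥0∞) :
    ∑' W : {W // IsRegion W}, κ ^ (boundary W.1).card ≤ (1 - 6 * κ)⁻¹ := by
  choose s hs hs' using fun W : {W // IsRegion W} => exists_ray W.2.zero_mem 0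
  -- The walk starts where the eastward ray from `0` leaves `W`. This ray is shorter than the
  -- perimeter `n`, so there are at most `n * 3 ^ n` codes.
  let enc : {W // IsRegion W} → Σ n : ℕ, Fin n × (Fin n → Fin 3) := fun W =>
    ⟨(boundary W.1).card, ⟨s W, east_extent_lt (hs W)⟩,
      fun k => turnCode W.1 ((next W.1)^[k] (0 + s W • vec 0, 0))⟩
  have henc : Function.Injective enc := by
    intro W W' h
    have h1 : (boundary W.1).card = (boundary W'.1).card := congrArg Sigma.fst h
    have h2 : s W = s W' := congrArg
      (fun p : Σ n : ℕ, Fin n × (Fin n → Fin 3) => (p.2.1 : ℕ)) h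
    have h3 := congrArg (fun (p : Σ n : ℕ, Fin n × (Fin n → Fin 3)) (k : ℕ) =>
      if hk : k < p.1 then p.2.2 ⟨k, hk⟩ else 0) h
    refine Subtype.ext (W.2.eq_of_turnCode_eq W'.2 (hs' W) (h2 ▸ hs' W') h1 fun k hk => ?_)
    have h4 := congrFun h3 k
    simp only [enc] at h4
    rw [dif_pos hk, dif_pos (h1 ▸ hk), ← h2] at h4
    exact h4
  calc ∑' W : {W // IsRegion W}, κ ^ (boundary W.1).card
      = ∑' W, (fun p : Σ n : ℕ, Fin n × (Fin n → Fin 3) => κ ^ p.1) (enc W) := rfl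
    _ ≤ ∑' p : Σ n : ℕ, Fin n × (Fin n → Fin 3), κ ^ p.1 :=
        ENNReal.tsum_comp_le_tsum_of_injective henc _
    _ = ∑' n : ℕ, ((n * 3 ^ n : ℕ) : ℝ≥0∞) * κ ^ n := by
        rw [ENNReal.tsum_sigma']
        congr 1; ext n
        rw [tsum_fintype]
        simp [Finset.sum_const, Finset.card_univ]
    _ ≤ ∑' n : ℕ, (6 * κ) ^ n := by
        refine ENNReal.tsum_le_tsum fun n => ?_
        rw [mul_pow]
        gcongr
        have : n * 3 ^ n ≤ 6 ^ n := by
          rw [show 6 = 2 * 3 by norm_num, mul_pow]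
          exact Nat.mul_le_mul_right _ Nat.lt_two_pow_self.le
        exact_mod_cast this
    _ = _ := ENNReal.tsum_geometric _

/-! ### Configurations around regions -/

/-- The lattice edge underlying a dart. -/
def edgeOf (e : Dart) : Edge := ⟨s(e.1, e.1 + vec e.2), adj_add_vec e.1 e.2⟩

lemma isHorizontal_edgeOf (e : Dart) : IsHorizontal (edgeOf e) ↔ e.2 = 0 ∨ e.2 = 2 := by
  obtain ⟨⟨a, b⟩, d⟩ := e
  fin_cases d <;> simp [IsHorizontal, edgeOf]

/-- Only one endpoint of a boundary edge lies in `W`, which fixes the orientation. -/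
lemma edgeOf_injOn_boundary (W : Finset (ℤ × ℤ)) : Set.InjOn edgeOf (boundary W) := by
  rintro ⟨v, d⟩ h ⟨v', d'⟩ h' heq
  have h1 := mem_boundary.1 h
  have h2 := mem_boundary.1 h'
  have h3 : s(v, v + vec d) = s(v', v' + vec d') := congrArg Subtype.val heq
  rcases Sym2.eq_iff.1 h3 with ⟨rfl, h4⟩ | ⟨rfl, h4⟩
  · rw [add_right_inj] at h4
    have hvec : ∀ d d', vec d = vec d' → d = d' := by decide
    rw [hvec d d' h4]
  · exact absurd h1.1 h2.2

/-- A step along an open edge. -/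
def OpenStep (ω : Config) (u v : ℤ × ℤ) : Prop :=
  ∃ h : squareLattice.Adj u v, ω ⟨s(u, v), h⟩ = true

lemma openStep_edgeOf {ω : Config} {v : ℤ × ℤ} {d : Fin 4} (h : ω (edgeOf (v, d)) = true) :
    OpenStep ω v (v + vec d) :=
  ⟨adj_add_vec v d, h⟩

lemma OpenStep.symm {ω : Config} {u v : ℤ × ℤ} (h : OpenStep ω u v) : OpenStep ω v u := by
  obtain ⟨h1, h2⟩ := h
  refine ⟨h1.symm, ?_⟩
  rw [← h2]
  exact congrArg ω (Subtype.ext Sym2.eq_swap)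

lemma openPath_symm {ω : Config} {u v : ℤ × ℤ} (h : ReflTransGen (OpenStep ω) u v) :
    ReflTransGen (OpenStep ω) v u := by
  induction h with
  | refl => exact .refl
  | tail _ h ih => exact .head h.symm ih

/-- The event that all boundary edges of `W` are closed. -/
def boundaryClosed (W : Finset (ℤ × ℤ)) : Set Config :=
  {ω | ∀ e ∈ boundary W, ω (edgeOf e) = false}

/-- The boundary edges of the filled cluster belong to the edge boundary of the cluster itself, so
they are closed. -/
lemma exists_isRegion_of_mem_finiteConnection {ω : Config} {x : ℤ × ℤ}
    (h : ω ∈ finiteConnection 0 x) :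
    ∃ W : Finset (ℤ × ℤ), IsRegion W ∧ x ∈ W ∧ ω ∈ boundaryClosed W := by
  obtain ⟨A, hA, h0, hx, hfin⟩ := h
  have hpath : ∀ z ∈ A.verts, ReflTransGen A.Adj 0 z := by
    intro z hz
    have hr : A.coe.Reachable ⟨0, h0⟩ ⟨z, hz⟩ := hA.connected.preconnected _ _
    rw [SimpleGraph.reachable_iff_reflTransGen] at hr
    exact ReflTransGen.lift Subtype.val (fun _ _ h => h) _ _ hr
  have hV : A.verts.Finite := by
    refine ((Set.finite_singleton (0 : ℤ × ℤ)).union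
      (hfin.biUnion fun e _ => e.toFinset.finite_toSet)).subset fun z hz => ?_
    rcases (hpath z hz).cases_tail with h | ⟨u, -, h⟩
    · exact Or.inl h
    · refine Or.inr (Set.mem_biUnion (x := s(u, z)) h ?_)
      simp
  obtain ⟨W, hW, hVW, hbd⟩ := exists_isRegion_of_connected hV h0 fun z hz =>
    ReflTransGen.mono
      (fun u v (h : A.Adj u v) => ⟨h.adj_sub, h.fst_mem, h.snd_mem⟩) _ _ (hpath z hz)
  refine ⟨W, hW, hVW hx, ?_⟩
  rintro ⟨v, d⟩ he
  obtain ⟨h1, h2⟩ := hbd v d he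
  refine hA.closed_boundary _ ⟨v, ⟨by simp [edgeOf], h1⟩, ?_⟩
  rintro w ⟨hw, hw'⟩
  rcases Sym2.mem_iff.1 hw with rfl | rfl
  · rfl
  · exact absurd hw' h2

/-- Open paths do not leave a region with closed boundary. -/
lemma mem_of_openPath {W : Finset (ℤ × ℤ)} {ω : Config} (hω : ω ∈ boundaryClosed W)
    {u v : ℤ × ℤ} (hu : u ∈ W) (h : ReflTransGen (OpenStep ω) u v) : v ∈ W := by
  induction h with
  | refl => exact hu
  | tail _ h ih =>
    obtain ⟨h1, h2⟩ := h
    obtain ⟨d, rfl⟩ := exists_vec_of_adj h1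
    by_contra hn
    have := hω _ (mem_boundary.2 ⟨ih, hn⟩)
    change _ = true at h2
    rw [edgeOf] at this
    simp [this] at h2

lemma mem_finiteConnection_of_openPath {W : Finset (ℤ × ℤ)} (h0 : (0 : ℤ × ℤ) ∈ W) {ω : Config}
    (hω : ω ∈ boundaryClosed W) {x : ℤ × ℤ} (hx : ReflTransGen (OpenStep ω) 0 x) :
    ω ∈ finiteConnection 0 x := by
  let V : Set (ℤ × ℤ) := {z | ReflTransGen (OpenStep ω) 0 z}
  have hVW : V ⊆ W := fun z hz => mem_of_openPath hω h0 hz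
  let A : squareLattice.Subgraph :=
    { verts := V
      Adj := fun u v => OpenStep ω u v ∧ u ∈ V ∧ v ∈ V
      adj_sub := fun h => h.1.1
      edge_vert := fun h => h.2.1
      symm := ⟨fun u v h => ⟨h.1.symm, h.2.2, h.2.1⟩⟩ }
  have h0V : (0 : ℤ × ℤ) ∈ V := ReflTransGen.refl
  refine ⟨A, ⟨⟨?_⟩, ?_, ?_⟩, h0V, hx, ?_⟩
  · rw [SimpleGraph.connected_iff_exists_forall_reachable]
    refine ⟨⟨0, h0V⟩, ?_⟩
    rintro ⟨z, hz⟩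
    have hz' : ReflTransGen (OpenStep ω) 0 z := hz
    induction hz' with
    | refl => exact SimpleGraph.Reachable.refl _
    | tail h h' ih =>
      exact (ih h).trans (SimpleGraph.Adj.reachable (show A.coe.Adj ⟨_, h⟩ ⟨_, hz⟩ from ⟨h', h, hz⟩))
  · rintro ⟨e, he⟩ h
    induction e with
    | _ u v => exact h.1.2
  · rintro ⟨e, he⟩ ⟨v, ⟨hv, hvV⟩, huniq⟩
    obtain ⟨w, rfl⟩ := Sym2.mem_iff_exists.1 hv
    by_contra ho
    have hw : w ∈ V := ReflTransGen.tail hvV ⟨he, by simpa using ho⟩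
    have := huniq w ⟨Sym2.mem_mk_right v w, hw⟩
    subst this
    exact squareLattice.loopless.irrefl _ he
  · refine ((W.finite_toSet.prod W.finite_toSet).image fun p => s(p.1, p.2)).subset ?_
    intro e he
    induction e with
    | _ u v => exact ⟨(u, v), ⟨hVW he.2.1, hVW he.2.2⟩, rfl⟩

/-- A region contains a number of edges proportional to its perimeter which, if open, connect all
vertices at its boundary, as well as a given vertex `x`, to the origin. -/
lemma IsRegion.exists_skeleton {W : Finset (ℤ × ℤ)} (hW : IsRegion W) {x : ℤ × ℤ} (hx : x ∈ W) :
    ∃ S : Finset Dart, S.card ≤ 4 * (boundary W).card ∧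
      (∀ v d, (v, d) ∈ S → v ∈ W ∧ v + vec d ∈ W) ∧
      ∀ ω : Config, (∀ e ∈ S, ω (edgeOf e) = true) →
        (∀ e ∈ boundary W, ReflTransGen (OpenStep ω) 0 e.1) ∧
          ReflTransGen (OpenStep ω) 0 x := by
  classical
  obtain ⟨m, hm, hm'⟩ := exists_ray hW.zero_mem 0
  obtain ⟨n, hn, hn'⟩ := exists_ray hx 0
  -- The candidates are the two edges along which the walk may move at each boundary dart, and the
  -- eastward rays from `0` and `x` to the boundary. Each ray is shorter than the perimeter, whence
  -- the constant `4`.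
  let S₀ : Finset Dart :=
    ((boundary W).image (fun e => (e.1, e.2 + 1)) ∪
      (boundary W).image (fun e => (e.1 + vec (e.2 + 1), e.2))) ∪
    ((Finset.range m).image (fun i : ℕ => ((0 : ℤ × ℤ) + i • vec 0, (0 : Fin 4))) ∪
      (Finset.range n).image (fun i : ℕ => (x + i • vec 0, (0 : Fin 4))))
  have hS₀ : S₀.card ≤ 4 * (boundary W).card := by
    refine (Finset.card_union_le _ _).trans ?_
    have h1 := Finset.card_union_le ((boundary W).image (fun e : Dart => (e.1, e.2 + 1)))
      ((boundary W).image (fun e => (e.1 + vec (e.2 + 1), e.2)))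
    have h2 := Finset.card_union_le
      ((Finset.range m).image (fun i : ℕ => ((0 : ℤ × ℤ) + i • vec 0, (0 : Fin 4))))
      ((Finset.range n).image (fun i : ℕ => (x + i • vec 0, (0 : Fin 4))))
    have h3 := Finset.card_image_le (s := boundary W) (f := fun e : Dart => (e.1, e.2 + 1))
    have h4 := Finset.card_image_le (s := boundary W)
      (f := fun e : Dart => (e.1 + vec (e.2 + 1), e.2))
    have h5 := Finset.card_image_le (s := Finset.range m)
      (f := fun i : ℕ => ((0 : ℤ × ℤ) + i • vec 0, (0 : Fin 4)))
    have h6 := Finset.card_image_le (s := Finset.range n)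
      (f := fun i : ℕ => (x + i • vec 0, (0 : Fin 4)))
    rw [Finset.card_range] at h5 h6
    have h7 := east_extent_lt hm
    have h8 := east_extent_lt hn
    omega
  refine ⟨S₀.filter fun e => e.1 ∈ W ∧ e.1 + vec e.2 ∈ W,
    (Finset.card_filter_le _ _).trans hS₀, fun v d h => (Finset.mem_filter.1 h).2,
    fun ω hω => ?_⟩
  have hop : ∀ v d, (v, d) ∈ S₀ → v ∈ W → v + vec d ∈ W → OpenStep ω v (v + vec d) :=
    fun v d h h1 h2 => openStep_edgeOf (hω _ (Finset.mem_filter.2 ⟨h, h1, h2⟩))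
  have ray : ∀ z : ℤ × ℤ, ∀ k : ℕ, (∀ i ≤ k, z + i • vec 0 ∈ W) →
      (∀ i < k, (z + i • vec 0, (0 : Fin 4)) ∈ S₀) →
      ReflTransGen (OpenStep ω) z (z + k • vec 0) := by
    intro z k
    induction k with
    | zero => intro _ _; simpa using ReflTransGen.refl
    | succ k ih =>
      intro h1 h2
      have h3 := h1 (k + 1) le_rfl
      rw [succ_nsmul, ← add_assoc] at h3 ⊢
      exact .tail (ih (fun i hi => h1 i (by omega)) fun i hi => h2 i (by omega))
        (hop _ _ (h2 k (by omega)) (h1 k (by omega)) h3)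
  have h0 : ReflTransGen (OpenStep ω) 0 (0 + m • vec 0) := ray 0 m hm fun i hi =>
    Finset.mem_union_right _ (Finset.mem_union_left _
      (Finset.mem_image.2 ⟨i, Finset.mem_range.2 hi, rfl⟩))
  have hx : ReflTransGen (OpenStep ω) x (x + n • vec 0) := ray x n hn fun i hi =>
    Finset.mem_union_right _ (Finset.mem_union_right _
      (Finset.mem_image.2 ⟨i, Finset.mem_range.2 hi, rfl⟩))
  have hstep : ∀ e ∈ boundary W, ReflTransGen (OpenStep ω) e.1 (next W e).1 := by
    rintro ⟨v, d⟩ he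
    have m1 : (v, d + 1) ∈ S₀ := Finset.mem_union_left _ (Finset.mem_union_left _
      (Finset.mem_image.2 ⟨_, he, rfl⟩))
    have m2 : (v + vec (d + 1), d) ∈ S₀ := Finset.mem_union_left _ (Finset.mem_union_right _
      (Finset.mem_image.2 ⟨_, he, rfl⟩))
    have hv := (mem_boundary.1 he).1
    unfold next turnCode
    by_cases h1 : v + vec (d + 1) ∈ W
    · have p1 := ReflTransGen.single (hop _ _ m1 hv h1)
      by_cases h2 : v + vec (d + 1) + vec d ∈ W
      · simpa [h1, h2, turn] using p1.tail (hop _ _ m2 h1 h2)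
      · simpa [h1, h2, turn] using p1
    · simpa [h1, turn] using ReflTransGen.refl
  have hbd : ∀ e ∈ boundary W, ReflTransGen (OpenStep ω) 0 e.1 := by
    intro e he
    obtain ⟨k, -, rfl⟩ := hW.exists_iterate hm' he
    clear he
    suffices h : (next W)^[k] (0 + m • vec 0, 0) ∈ boundary W ∧
        ReflTransGen (OpenStep ω) 0 ((next W)^[k] (0 + m • vec 0, 0)).1 from h.2
    induction k with
    | zero => exact ⟨hm', h0⟩
    | succ k ih =>
      rw [Function.iterate_succ_apply']
      exact ⟨next_mem ih.1, ih.2.trans (hstep _ ih.1)⟩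
  exact ⟨hbd, (hbd _ hn').trans (openPath_symm hx)⟩

/-- A set of inner edges of a region chosen by `IsRegion.exists_skeleton`. -/
def skeleton {W : Finset (ℤ × ℤ)} (hW : IsRegion W) {x : ℤ × ℤ} (hx : x ∈ W) : Finset Dart :=
  (hW.exists_skeleton hx).choose

/-- The event that the boundary of a region is closed and its skeleton is open. -/
def isolated {W : Finset (ℤ × ℤ)} (hW : IsRegion W) {x : ℤ × ℤ} (hx : x ∈ W) : Set Config :=
  {ω | ω ∈ boundaryClosed W ∧ ∀ e ∈ skeleton hW hx, ω (edgeOf e) = true}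

lemma isolated_subset_finiteConnection {W : Finset (ℤ × ℤ)} (hW : IsRegion W) {x : ℤ × ℤ}
    (hx : x ∈ W) : isolated hW hx ⊆ finiteConnection 0 x := fun ω hω =>
  mem_finiteConnection_of_openPath hW.zero_mem hω.1
    ((hW.exists_skeleton hx).choose_spec.2.2 ω hω.2).2

/-- From a point of `W` outside `W'`, follow an escape path avoiding `W'` until it leaves `W`. The
exit vertex is joined to `0` by open edges, which cannot cross the closed boundary of `W'`, so it
lies in `W'`: a contradiction. -/
lemma subset_of_mem_isolated {W W' : Finset (ℤ × ℤ)} (hW : IsRegion W) (hW' : IsRegion W')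
    {x : ℤ × ℤ} (hx : x ∈ W) (hx' : x ∈ W') {ω : Config} (hω : ω ∈ isolated hW hx)
    (hω' : ω ∈ isolated hW' hx') : W ⊆ W' := by
  intro z hz
  by_contra hn
  obtain ⟨M, hM⟩ := (W.image Prod.fst).bddAbove
  obtain ⟨z', h1, h2⟩ := hW'.escape z hn (M + 1)
  have hz' : z' ∈ W := by
    clear h1
    induction h2 with
    | refl => exact hz
    | tail _ h ih =>
      obtain ⟨d, rfl⟩ := exists_vec_of_adj h.1
      by_contra hout
      have := ((hW.exists_skeleton hx).choose_spec.2.2 ω hω.2).1 _ (mem_boundary.2 ⟨ih, hout⟩)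
      exact h.2.1 (mem_of_openPath hω'.1 hW'.zero_mem this)
  have : z'.1 ≤ M := hM (Finset.mem_coe.2 (Finset.mem_image.2 ⟨_, hz', rfl⟩))
  omega

/-! ### Probabilities -/

section Probability

variable (ph pv : I)

lemma edgeLaw_false (e : Edge) [Decidable (IsHorizontal e)] :
    edgeLaw ph pv e {false} =
      ENNReal.ofReal (if IsHorizontal e then 1 - (ph : ℝ) else 1 - (pv : ℝ)) := by
  classical
  rw [← ENNReal.ofReal_toReal (measure_ne_top (edgeLaw ph pv e) {false}),
    ← measureReal_def, edgeLaw,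
    bernoulliMeasure_real_apply_of_notMem_of_mem _ (measurableSet_singleton _) (by simp) (by simp)]
  split_ifs <;> simp

lemma edgeLaw_true (e : Edge) [Decidable (IsHorizontal e)] :
    edgeLaw ph pv e {true} = ENNReal.ofReal (if IsHorizontal e then (ph : ℝ) else (pv : ℝ)) := by
  classical
  rw [← ENNReal.ofReal_toReal (measure_ne_top (edgeLaw ph pv e) {true}),
    ← measureReal_def, edgeLaw,
    bernoulliMeasure_real_apply_of_mem_of_notMem _ (measurableSet_singleton _) (by simp) (by simp)]
  split_ifs <;> simp

lemma prod_edgeLaw_boundary (W : Finset (ℤ × ℤ)) :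
    ∏ e ∈ boundary W, edgeLaw ph pv (edgeOf e) {false} =
      ENNReal.ofReal ((1 - ph) ^ horizontalPerimeter W * (1 - pv) ^ verticalPerimeter W) := by
  classical
  have h1 : (0 : ℝ) ≤ 1 - ph := sub_nonneg.2 ph.2.2
  have h2 : (0 : ℝ) ≤ 1 - pv := sub_nonneg.2 pv.2.2
  simp_rw [edgeLaw_false, isHorizontal_edgeOf]
  rw [← ENNReal.ofReal_prod_of_nonneg (fun e _ => by split_ifs <;> assumption),
    Finset.prod_ite, Finset.prod_const, Finset.prod_const]
  rfl

lemma percolation_boundaryClosed (W : Finset (ℤ × ℤ)) :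
    percolation ph pv (boundaryClosed W) =
      ENNReal.ofReal ((1 - ph) ^ horizontalPerimeter W * (1 - pv) ^ verticalPerimeter W) := by
  classical
  have h : boundaryClosed W =
      Set.pi ((boundary W).image edgeOf : Finset Edge) fun _ => {false} := by
    ext ω
    exact ⟨fun h e he => by obtain ⟨f, hf, rfl⟩ := Finset.mem_image.1 he; exact h f hf,
      fun h f hf => h _ (Finset.mem_image_of_mem _ hf)⟩
  rw [h, percolation, Measure.infinitePi_pi _ (fun _ _ => measurableSet_singleton _),
    Finset.prod_image (edgeOf_injOn_boundary W), prod_edgeLaw_boundary]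

variable {W : Finset (ℤ × ℤ)} (hW : IsRegion W) {x : ℤ × ℤ} (hx : x ∈ W)

/-- Skeleton edges have both endpoints in `W`, boundary edges only one, so the two requirements
never conflict and the event is a cylinder. -/
lemma isolated_eq_pi [DecidableEq Edge] : isolated hW hx =
    Set.pi (((boundary W).image edgeOf ∪ (skeleton hW hx).image edgeOf : Finset Edge) : Set Edge)
      (fun e => if e ∈ (boundary W).image edgeOf then {false} else {true}) := by
  have hdisj : ∀ e ∈ skeleton hW hx, edgeOf e ∉ (boundary W).image edgeOf := by
    rintro ⟨v, d⟩ h hm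
    have h1 := (hW.exists_skeleton hx).choose_spec.2.1 v d h
    obtain ⟨⟨v', d'⟩, h2, h3⟩ := Finset.mem_image.1 hm
    have h4 := mem_boundary.1 h2
    have h5 : s(v', v' + vec d') = s(v, v + vec d) := congrArg Subtype.val h3
    rcases Sym2.eq_iff.1 h5 with ⟨-, h6⟩ | ⟨-, h6⟩
    · exact h4.2 (h6 ▸ h1.2)
    · exact h4.2 (h6 ▸ h1.1)
  ext ω
  constructor
  · rintro ⟨h1, h2⟩ e he
    rcases Finset.mem_union.1 he with h | h
    · obtain ⟨f, hf, rfl⟩ := Finset.mem_image.1 h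
      simpa only [if_pos h, Set.mem_singleton_iff] using h1 f hf
    · obtain ⟨f, hf, rfl⟩ := Finset.mem_image.1 h
      simpa only [if_neg (hdisj f hf), Set.mem_singleton_iff] using h2 f hf
  · intro h
    refine ⟨fun e he => ?_, fun e he => ?_⟩
    · have hm := Finset.mem_image_of_mem edgeOf he
      have := h _ (Finset.mem_union_left _ hm)
      simpa only [if_pos hm, Set.mem_singleton_iff] using this
    · have := h _ (Finset.mem_union_right _ (Finset.mem_image_of_mem edgeOf he))
      simpa only [if_neg (hdisj e he), Set.mem_singleton_iff] using this

lemma measurableSet_isolated : MeasurableSet (isolated hW hx) := by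
  classical
  rw [isolated_eq_pi]
  exact MeasurableSet.pi (Finset.countable_toSet _) fun _ _ => .of_discrete

lemma le_percolation_isolated (hp : (ph : ℝ) ≤ pv) :
    ENNReal.ofReal ((1 - ph) ^ horizontalPerimeter W * (1 - pv) ^ verticalPerimeter W *
      ph ^ (4 * (boundary W).card)) ≤ percolation ph pv (isolated hW hx) := by
  classical
  set C := (boundary W).image edgeOf
  set O := (skeleton hW hx).image edgeOf
  have h1 : (0 : ℝ) ≤ 1 - ph := sub_nonneg.2 ph.2.2
  have h2 : (0 : ℝ) ≤ 1 - pv := sub_nonneg.2 pv.2.2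
  have hcard : (O \ C).card ≤ 4 * (boundary W).card :=
    (Finset.card_le_card Finset.sdiff_subset).trans
      (Finset.card_image_le.trans (hW.exists_skeleton hx).choose_spec.1)
  rw [isolated_eq_pi, percolation, Measure.infinitePi_pi _ (fun _ _ => .of_discrete),
    ← Finset.union_sdiff_self_eq_union, Finset.prod_union Finset.disjoint_sdiff,
    ENNReal.ofReal_mul (by positivity), ← prod_edgeLaw_boundary]
  gcongr ?_ * ?_
  · rw [Finset.prod_congr rfl (g := fun e => edgeLaw ph pv e {false})
        (fun e he => by rw [if_pos he]),
      Finset.prod_image (edgeOf_injOn_boundary W)]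
  · rw [Finset.prod_congr rfl (g := fun e => edgeLaw ph pv e {true})
      (fun e he => by rw [if_neg (Finset.mem_sdiff.1 he).2])]
    calc ENNReal.ofReal ((ph : ℝ) ^ (4 * (boundary W).card))
        ≤ ENNReal.ofReal ((ph : ℝ) ^ (O \ C).card) :=
          ENNReal.ofReal_le_ofReal (pow_le_pow_of_le_one ph.2.1 ph.2.2 hcard)
      _ = ∏ e ∈ O \ C, ENNReal.ofReal (ph : ℝ) := by
          rw [Finset.prod_const, ENNReal.ofReal_pow ph.2.1]
      _ ≤ _ := by
          refine Finset.prod_le_prod' fun e _ => ?_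
          rw [edgeLaw_true]
          refine ENNReal.ofReal_le_ofReal ?_
          split_ifs
          · exact le_rfl
          · exact hp

lemma tsum_percolation_isolated_le (x : ℤ × ℤ) :
    ∑' W : {W : Finset (ℤ × ℤ) // IsRegion W ∧ x ∈ W},
        percolation ph pv (isolated W.2.1 W.2.2) ≤
      percolation ph pv (finiteConnection 0 x) := by
  rw [← measure_iUnion]
  · exact measure_mono (Set.iUnion_subset fun W => isolated_subset_finiteConnection _ _)
  · intro W W' hne
    refine Set.disjoint_left.2 fun ω h h' => hne (Subtype.ext ?_)
    exact (subset_of_mem_isolated _ _ _ _ h h').antisymm (subset_of_mem_isolated _ _ _ _ h' h)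
  · exact fun W => measurableSet_isolated _ _

/-- A union bound over the regions containing `x.swap`, reindexed by their reflections so as to run
over the same regions as the lower bound. -/
lemma percolation_finiteConnection_swap_le (x : ℤ × ℤ) :
    percolation ph pv (finiteConnection 0 x.swap) ≤
      ∑' W : {W : Finset (ℤ × ℤ) // IsRegion W ∧ x ∈ W},
        percolation ph pv (boundaryClosed (reflect W.1)) := by
  refine (measure_mono fun ω hω => ?_).trans (measure_iUnion_le _)
  obtain ⟨W, hW, hx, h⟩ := exists_isRegion_of_mem_finiteConnection hω
  exact Set.mem_iUnion.2 ⟨⟨reflect W, hW.reflect, by simpa using hx⟩, by simpa using h⟩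

end Probability

/-! ### Comparison of weights -/

/-- If the perimeter of a region has a definite surplus of horizontal edges, reflecting the region
decreases the weight by a definite factor. -/
lemma reflected_weight_le {θ p a b : ℝ} {M H U : ℕ} (hθ₀ : 0 ≤ θ) (hθ₁ : θ ≤ 1) (hp₀ : 0 ≤ p)
    (hp₁ : p ≤ 1) (ha : 0 ≤ a) (hb : 0 ≤ b) (hba : b ≤ θ * p ^ (4 * M) * a) (hpos : 0 < H + U)
    (hM : H + U + M * U ≤ M * H) :
    a ^ U * b ^ H ≤ θ * (a ^ H * b ^ U * p ^ (4 * (H + U))) := by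
  obtain ⟨k, rfl⟩ : ∃ k, H = U + k := by
    refine ⟨H - U, (Nat.add_sub_of_le ?_).symm⟩
    by_contra! h
    have := Nat.mul_le_mul_left M h.le
    omega
  have hk : U + k + U ≤ M * k := by rw [mul_add] at hM; omega
  have hk0 : k ≠ 0 := by rintro rfl; omega
  -- Each of the `k = H - U` exchanged factors yields `p ^ (4 * M)`, and `M * k` is at least the
  -- perimeter. A single `θ` is kept.
  have h1 : b ^ k ≤ θ * p ^ (4 * (U + k + U)) * a ^ k :=
    calc b ^ k ≤ (θ * p ^ (4 * M) * a) ^ k := by gcongr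
      _ = θ ^ k * p ^ (4 * M * k) * a ^ k := by rw [mul_pow, mul_pow, ← pow_mul]
      _ ≤ θ * p ^ (4 * (U + k + U)) * a ^ k := by
        gcongr ?_ * ?_ * _
        · exact pow_le_of_le_one hθ₀ hθ₁ hk0
        · exact pow_le_pow_of_le_one hp₀ hp₁ (by rw [mul_assoc]; omega)
  calc a ^ U * b ^ (U + k) = a ^ U * b ^ U * b ^ k := by ring
    _ ≤ a ^ U * b ^ U * (θ * p ^ (4 * (U + k + U)) * a ^ k) := by gcongr
    _ = _ := by ring

/-- A long perimeter costs much more than a minimal one. -/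
lemma weight_le_of_excess {κ a b : ℝ} {m N H U : ℕ} (hκ₀ : 0 ≤ κ) (hκ₁ : κ ≤ 1) (ha : 0 ≤ a)
    (hb : 0 ≤ b) (hba : b ≤ a) (haκ : a ≤ κ ^ m) (hN : N ≤ H + U)
    (hm : 2 * (H + U) ≤ m * (H + U - N)) :
    a ^ U * b ^ H ≤ a ^ N * κ ^ N * κ ^ (H + U) := by
  obtain ⟨k, hk⟩ := Nat.exists_eq_add_of_le hN
  calc a ^ U * b ^ H ≤ a ^ U * a ^ H := by gcongr
    _ = a ^ N * a ^ k := by rw [← pow_add, ← pow_add, add_comm U, hk]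
    _ ≤ a ^ N * (κ ^ m) ^ k := by gcongr
    _ ≤ a ^ N * κ ^ (N + (H + U)) := by
      rw [← pow_mul]
      gcongr ?_ * ?_
      -- The factor `2` in `hm` pays for both `κ ^ N` and `κ ^ (H + U)`, because `N ≤ H + U`.
      refine pow_le_pow_of_le_one hκ₀ hκ₁ ?_
      rw [hk, Nat.add_sub_cancel_left] at hm
      omega
    _ = _ := by rw [pow_add, mul_assoc]

/-- Applied to the box. Each factor `κ` covers the loss `η` from a vertical edge and `p ^ 4` from
the skeleton, and contributes an `ε`, of which one is kept. -/
lemma minimal_weight_ge {η κ ε p a b : ℝ} {N H U : ℕ} (hη₀ : 0 ≤ η) (hη₁ : η ≤ 1) (hε₀ : 0 ≤ ε)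
    (hε₁ : ε ≤ 1) (hp₀ : 0 ≤ p) (hp₁ : p ≤ 1) (ha₀ : 0 ≤ a) (ha₁ : a ≤ 1) (hab : η * a ≤ b)
    (hκ₀ : 0 ≤ κ) (hκ : κ ≤ ε * (η * p ^ 4)) (hN : N ≠ 0) (hHU : H + U ≤ N) :
    a ^ N * κ ^ N ≤ ε * (a ^ H * b ^ U * p ^ (4 * (H + U))) := by
  have hle : a * (η * p ^ 4) ≤ 1 :=
    mul_le_one₀ ha₁ (by positivity) (mul_le_one₀ hη₁ (by positivity) (pow_le_one₀ hp₀ hp₁))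
  calc a ^ N * κ ^ N ≤ a ^ N * (ε * (η * p ^ 4)) ^ N := by gcongr
    _ = ε ^ N * (a * (η * p ^ 4)) ^ N := by rw [mul_pow, mul_pow a]; ring
    _ ≤ ε * (a * (η * p ^ 4)) ^ (H + U) := by
      gcongr ?_ * ?_
      · exact pow_le_of_le_one hε₀ hε₁ hN
      · exact pow_le_pow_of_le_one (by positivity) hle hHU
    _ = ε * (a ^ H * (η * a) ^ U * (η ^ H * p ^ (4 * (H + U)))) := by
      rw [mul_pow a, mul_pow, mul_pow, ← pow_mul, pow_add a, pow_add η]; ring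
    _ ≤ ε * (a ^ H * b ^ U * (1 * p ^ (4 * (H + U)))) := by
      have hb₀ : 0 ≤ b := (mul_nonneg hη₀ ha₀).trans hab
      have := pow_le_one₀ hη₀ hη₁ (n := H)
      gcongr
    _ = _ := by rw [one_mul]

/-- Without a surplus of horizontal edges, the perimeter of a region containing `0` and `(x₁, x₂)`
exceeds the minimal one by a positive fraction. -/
lemma excess_of_no_surplus {ρ : ℝ} {M : ℕ} (hM : 2 * (ρ + 3) ≤ M * (ρ - 1)) (hM₁ : 1 ≤ M)
    {x₁ x₂ : ℤ} (hx₁ : 0 < x₁) (hx : (x₂ : ℝ) = ρ * x₁) {N H U : ℕ}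
    (hN : (N : ℤ) = 2 * (x₂ + 1) + 2 * (x₁ + 1)) (hH : 2 * (x₂ + 1) ≤ (H : ℤ))
    (hU : 2 * (x₁ + 1) ≤ (U : ℤ)) (h : ¬H + U + M * U ≤ M * H) :
    2 * (H + U) ≤ 2 * (M + 2) * (H + U - N) := by
  have hNL : N ≤ H + U := by omega
  have hNr : (N : ℝ) = 2 * (x₂ + 1) + 2 * (x₁ + 1) := by exact_mod_cast hN
  have hHr : 2 * ((x₂ : ℝ) + 1) ≤ H := by exact_mod_cast hH
  have hUr : 2 * ((x₁ : ℝ) + 1) ≤ U := by exact_mod_cast hU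
  have hr : (M : ℝ) * H < H + U + M * U := by exact_mod_cast not_le.1 h
  have hx₁r : (1 : ℝ) ≤ x₁ := by exact_mod_cast hx₁
  have hM₁r : (1 : ℝ) ≤ M := by exact_mod_cast hM₁
  have key : (H : ℝ) + U ≤ (M + 2) * (H + U - N) := by
    have h1 : 2 * (ρ + 3) * x₁ ≤ M * (x₂ - x₁) := by
      rw [hx]
      nlinarith
    -- Here `N = 2 (ρ + 1) x₁ + 4 ≤ 2 (ρ + 3) x₁` because `x₁ ≥ 1`; this is the origin of the
    -- constant in `hM`.
    have h2 : 2 * (N : ℝ) ≤ 2 * (M * (x₂ - x₁)) := by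
      rw [hNr, hx] at *
      nlinarith
    have h3 : 0 ≤ ((M : ℝ) - 1) * (H - 2 * (x₂ + 1)) :=
      mul_nonneg (by linarith) (by linarith)
    have h4 : 0 ≤ ((M : ℝ) + 1) * (H - 2 * (x₂ + 1)) :=
      mul_nonneg (by linarith) (by linarith)
    nlinarith
  rw [mul_assoc]
  refine Nat.mul_le_mul_left 2 ?_
  have : ((H + U : ℕ) : ℝ) ≤ ((M + 2) * (H + U - N) : ℕ) := by
    push_cast [Nat.cast_sub hNL]
    exact key
  exact_mod_cast this

/-- The comparison of the two connectivities, in terms of explicit conditions on the parameters. -/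
lemma percolation_swap_lt {ρ η : ℝ} {M : ℕ} {ph pv : I} (hη₀ : 0 < η) (hη₁ : η < 1)
    (hM : 2 * (ρ + 3) ≤ M * (ρ - 1)) (hM₁ : 1 ≤ M)
    (hp : (1 / 2 : ℝ) ≤ (ph : ℝ) ^ 4) (hlt : (ph : ℝ) < 1) (hpp : (ph : ℝ) ≤ pv)
    (hqκ : 1 - (ph : ℝ) ≤ (η * (1 - η) / 16) ^ (2 * (M + 2)))
    (hηq : η * (1 - (ph : ℝ)) ≤ 1 - (pv : ℝ))
    (hqq : 1 - (pv : ℝ) ≤ (1 + η) / 2 * (ph : ℝ) ^ (4 * M) * (1 - (ph : ℝ)))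
    {x : ℤ × ℤ} (hx₁ : 0 < x.1) (hx₂ : 0 < x.2) (hx : (x.2 : ℝ) = ρ * x.1) :
    percolation ph pv (finiteConnection 0 x.swap) < percolation ph pv (finiteConnection 0 x) := by
  set a : ℝ := 1 - ph with ha
  set b : ℝ := 1 - pv with hb
  -- The constants satisfy `θ + 2 * ε = (3 + η) / 4 < 1` and `κ = ε * η / 2 ≤ ε * (η * ph ^ 4)`.
  -- Also `6 * κ ≤ 1 / 2`, so the Peierls sum is at most `2`.
  set θ : ℝ := (1 + η) / 2 with hθ
  set κ : ℝ := η * (1 - η) / 16 with hκ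
  set ε : ℝ := (1 - η) / 8 with hε
  have hp₀ : (0 : ℝ) < ph := by
    rcases ph.2.1.lt_or_eq with h | h
    · exact h
    · rw [← h] at hp; norm_num at hp
  have ha₀ : 0 < a := by rw [ha]; linarith
  have ha₁ : a ≤ 1 := by rw [ha]; linarith
  have hb₀ : 0 < b := (mul_pos hη₀ ha₀).trans_le hηq
  have hκ₀ : 0 < κ := by rw [hκ]; have := sub_pos.2 hη₁; positivity
  have hκ₁ : κ ≤ 1 / 12 := by rw [hκ]; nlinarith
  obtain ⟨N, hN⟩ : ∃ N : ℕ, (N : ℤ) = 2 * (x.2 + 1) + 2 * (x.1 + 1) :=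
    ⟨(2 * (x.2 + 1) + 2 * (x.1 + 1)).toNat, Int.toNat_of_nonneg (by omega)⟩
  have hbox : IsRegion (box x) := isRegion_box hx₁.le hx₂.le
  have hxbox : x ∈ box x := by simp [hx₁.le, hx₂.le]
  set τ := percolation ph pv (finiteConnection 0 x) with hτ
  have hτtop : τ ≠ ∞ := by
    have : IsProbabilityMeasure (percolation ph pv) := by unfold percolation; infer_instance
    exact measure_ne_top _ _
  have hboxτ : percolation ph pv (isolated hbox hxbox) ≤ τ :=
    measure_mono (isolated_subset_finiteConnection _ _)
  have hminimal : ENNReal.ofReal (a ^ N * κ ^ N) ≤ ENNReal.ofReal ε * τ := by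
    refine le_trans (ENNReal.ofReal_le_ofReal (minimal_weight_ge (ε := ε) (p := ph) (b := b)
      hη₀.le hη₁.le (by rw [hε]; linarith) (by rw [hε]; linarith) hp₀.le ph.2.2 ha₀.le ha₁ hηq
      hκ₀.le ?_ (by omega) (H := horizontalPerimeter (box x)) (U := verticalPerimeter (box x)) ?_)) ?_
    · rw [hκ, hε]
      have h1 : 0 ≤ η * (1 - η) := mul_nonneg hη₀.le (by linarith)
      nlinarith
    · have h1 := horizontalPerimeter_box_le hx₂.le
      have h2 := verticalPerimeter_box_le hx₁.le
      omega
    · rw [ENNReal.ofReal_mul (by rw [hε]; linarith)]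
      gcongr
      refine le_trans ?_ hboxτ
      rw [horizontalPerimeter_add_verticalPerimeter]
      exact le_percolation_isolated ph pv hbox hxbox hpp
  -- Positivity is what makes the final inequality strict.
  have hτpos : τ ≠ 0 := by
    intro h0
    rw [h0, mul_zero, nonpos_iff_eq_zero, ENNReal.ofReal_eq_zero] at hminimal
    exact absurd hminimal (not_le.2 (by positivity))
  have hterm : ∀ W : {W : Finset (ℤ × ℤ) // IsRegion W ∧ x ∈ W},
      percolation ph pv (boundaryClosed (reflect W.1)) ≤
        ENNReal.ofReal θ * percolation ph pv (isolated W.2.1 W.2.2) +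
          ENNReal.ofReal (a ^ N * κ ^ N) * ENNReal.ofReal κ ^ (boundary W.1).card := by
    rintro ⟨W, hW, hxW⟩
    dsimp only
    have hH := hW.le_horizontalPerimeter hxW hx₂.le
    have hU := hW.le_verticalPerimeter hxW hx₁.le
    have hL := horizontalPerimeter_add_verticalPerimeter W
    have hiso := le_percolation_isolated ph pv hW hxW hpp
    rw [percolation_boundaryClosed, horizontalPerimeter_reflect, verticalPerimeter_reflect]
    rw [← hL] at hiso ⊢
    by_cases hgood : horizontalPerimeter W + verticalPerimeter W + M * verticalPerimeter W ≤
        M * horizontalPerimeter W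
    · refine le_trans ?_ le_self_add
      refine le_trans (ENNReal.ofReal_le_ofReal (reflected_weight_le (θ := θ) (p := ph)
        (by rw [hθ]; linarith) (by rw [hθ]; linarith) hp₀.le ph.2.2 ha₀.le hb₀.le hqq
        (by omega) hgood)) ?_
      rw [ENNReal.ofReal_mul (by rw [hθ]; linarith)]
      gcongr
    · refine le_trans ?_ le_add_self
      rw [← ENNReal.ofReal_pow hκ₀.le, ← ENNReal.ofReal_mul (by positivity)]
      refine ENNReal.ofReal_le_ofReal (weight_le_of_excess (m := 2 * (M + 2)) hκ₀.le
        (by linarith) ha₀.le hb₀.le (by linarith) hqκ (by omega) ?_)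
      exact excess_of_no_surplus hM hM₁ hx₁ hx hN hH hU hgood
  have hpeierls : ∑' W : {W : Finset (ℤ × ℤ) // IsRegion W ∧ x ∈ W},
      ENNReal.ofReal κ ^ (boundary W.1).card ≤ 2 := by
    have h1 := ENNReal.tsum_comp_le_tsum_of_injective
      (f := fun W : {W : Finset (ℤ × ℤ) // IsRegion W ∧ x ∈ W} =>
        (⟨W.1, W.2.1⟩ : {W // IsRegion W}))
      (fun W W' h => Subtype.ext (Subtype.mk.inj h))
      (fun W => ENNReal.ofReal κ ^ (boundary W.1).card)
    refine (h1.trans (tsum_pow_card_boundary_le _)).trans ?_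
    rw [ENNReal.inv_le_iff_inv_le]
    have h2 : 6 * ENNReal.ofReal κ ≤ 2⁻¹ := by
      rw [show (6 : ℝ≥0∞) = ENNReal.ofReal 6 by simp, ← ENNReal.ofReal_mul (by norm_num),
        show (2⁻¹ : ℝ≥0∞) = ENNReal.ofReal 2⁻¹ by
          rw [ENNReal.ofReal_inv_of_pos (by norm_num)]; simp]
      exact ENNReal.ofReal_le_ofReal (by linarith)
    calc (2⁻¹ : ℝ≥0∞) = 1 - 2⁻¹ := ENNReal.one_sub_inv_two.symm
      _ ≤ _ := by gcongr
  calc percolation ph pv (finiteConnection 0 x.swap)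
      ≤ _ := percolation_finiteConnection_swap_le ph pv x
    _ ≤ _ := ENNReal.tsum_le_tsum hterm
    _ ≤ ENNReal.ofReal θ * τ + ENNReal.ofReal (a ^ N * κ ^ N) * 2 := by
        rw [ENNReal.tsum_add, ENNReal.tsum_mul_left, ENNReal.tsum_mul_left]
        gcongr
        exact tsum_percolation_isolated_le ph pv x
    _ ≤ ENNReal.ofReal θ * τ + ENNReal.ofReal ε * τ * 2 := by gcongr
    _ = ENNReal.ofReal (θ + 2 * ε) * τ := by
        rw [ENNReal.ofReal_add (by rw [hθ]; linarith) (by rw [hε]; linarith),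
          ENNReal.ofReal_mul (by norm_num)]
        simp only [ENNReal.ofReal_ofNat]
        ring
    _ < 1 * τ := by
        refine ENNReal.mul_lt_mul_left hτpos hτtop ?_
        rw [← ENNReal.ofReal_one]
        exact (ENNReal.ofReal_lt_ofReal_iff one_pos).2 (by rw [hθ, hε]; linarith)
    _ = τ := one_mul _

end AnisotropicPercolation

end

/-! ### Choice of the threshold. -/

theorem theorem1 (ρ η : ℝ) (hρ : 1 < ρ) (hη₀ : 0 < η) (hη₁ : η < 1) :
    ∃ pstar : ℝ, 0 < pstar ∧ pstar < 1 ∧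
      ∀ ph pv : unitInterval, pstar < (ph : ℝ) → (ph : ℝ) < 1 → 0 < (pv : ℝ) →
        AnisotropicPercolation.odds pv / AnisotropicPercolation.odds ph = η →
        ∀ x₁ x₂ : ℤ, 0 < x₁ → 0 < x₂ → (x₂ : ℝ) = ρ * (x₁ : ℝ) →
          AnisotropicPercolation.truncatedConnectivity ph pv (0, 0) (x₂, x₁) <
            AnisotropicPercolation.truncatedConnectivity ph pv (0, 0) (x₁, x₂) := by
  obtain ⟨M₀, hM₀⟩ := exists_nat_ge (2 * (ρ + 3) / (ρ - 1))
  set M := M₀ + 1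
  have hM : 2 * (ρ + 3) ≤ M * (ρ - 1) := by
    rw [div_le_iff₀ (by linarith)] at hM₀
    push_cast [M]
    linarith
  set κ : ℝ := η * (1 - η) / 16
  have hκ₀ : 0 < κ := by have := sub_pos.2 hη₁; positivity
  have hκ₁ : κ ≤ 1 / 16 := by simp only [κ]; nlinarith
  -- The first bound makes long contours negligible. By Bernoulli's inequality, the second gives `ph
  -- ^ (4 * M + 1) ≥ (1 + η) / 2`.
  set δ : ℝ := min (κ ^ (2 * (M + 2))) ((1 - η) / (2 * (4 * M + 1 : ℕ)))
  have hδ₀ : 0 < δ := lt_min (by positivity) (div_pos (by linarith) (by positivity))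
  have hδκ : δ ≤ κ ^ (2 * (M + 2)) := min_le_left _ _
  have hδM : (4 * M + 1 : ℕ) * δ ≤ (1 - η) / 2 := by
    have h := min_le_right (κ ^ (2 * (M + 2))) ((1 - η) / (2 * (4 * M + 1 : ℕ)))
    rw [le_div_iff₀ (by positivity)] at h
    change δ * _ ≤ _ at h
    linarith
  have hδ₁ : δ ≤ 1 / 16 := (hδκ.trans (pow_le_of_le_one hκ₀.le (by linarith) (by omega))).trans hκ₁
  refine ⟨1 - δ, by linarith, by linarith, fun ph pv hph hlt hpv hodds x₁ x₂ hx₁ hx₂ hx => ?_⟩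
  have hp₀ : (0 : ℝ) < ph := by linarith
  have hq₀ : 0 < 1 - (ph : ℝ) := by linarith
  have hbern : ∀ n : ℕ, 1 - n * δ ≤ (ph : ℝ) ^ n := fun n => by
    have := one_add_mul_le_pow (a := (ph : ℝ) - 1) (by linarith) n
    have h2 : (n : ℝ) * (1 - ph) ≤ n * δ := by gcongr; linarith
    rw [add_sub_cancel] at this
    linarith
  have hodds' : (1 - (pv : ℝ)) * ph = η * (1 - (ph : ℝ)) * pv := by
    unfold AnisotropicPercolation.odds at hodds
    have h1 : 1 - (ph : ℝ) ≠ 0 := hq₀.ne'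
    have h2 : (ph : ℝ) ≠ 0 := hp₀.ne'
    have h3 : (pv : ℝ) ≠ 0 := hpv.ne'
    field_simp at hodds
    linarith
  have hpp : (ph : ℝ) ≤ pv := by
    have : η * ((1 - (ph : ℝ)) * pv) ≤ 1 * ((1 - (ph : ℝ)) * pv) := by gcongr
    nlinarith
  have hηq : η * (1 - (ph : ℝ)) ≤ 1 - (pv : ℝ) := by
    refine le_of_mul_le_mul_right ?_ hp₀
    rw [hodds']
    gcongr
  have hqq : 1 - (pv : ℝ) ≤ (1 + η) / 2 * (ph : ℝ) ^ (4 * M) * (1 - (ph : ℝ)) := by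
    refine le_of_mul_le_mul_right ?_ hp₀
    -- It suffices that `η ≤ ((1 + η) / 2) ^ 2`. The additional power of `ph` comes from clearing
    -- the denominator in the odds.
    have h1 : η ≤ (1 + η) / 2 * (ph : ℝ) ^ (4 * M + 1) := by
      have := (hbern (4 * M + 1))
      have h2 : (1 + η) / 2 ≤ (ph : ℝ) ^ (4 * M + 1) := by linarith
      nlinarith [sq_nonneg (1 - η)]
    calc (1 - (pv : ℝ)) * ph = η * (1 - (ph : ℝ)) * pv := hodds'
      _ ≤ η * (1 - (ph : ℝ)) * 1 := by gcongr; exact pv.2.2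
      _ ≤ (1 + η) / 2 * (ph : ℝ) ^ (4 * M + 1) * (1 - (ph : ℝ)) * 1 := by gcongr
      _ = _ := by ring
  have hp4 : (1 / 2 : ℝ) ≤ (ph : ℝ) ^ 4 := by
    have := hbern 4
    push_cast at this
    linarith
  have h := AnisotropicPercolation.percolation_swap_lt (x := (x₁, x₂)) hη₀ hη₁ hM (by omega) hp4
    hlt hpp (by linarith) hηq hqq hx₁ hx₂ hx
  have : IsProbabilityMeasure (AnisotropicPercolation.percolation ph pv) := by
    unfold AnisotropicPercolation.percolation; infer_instance
  exact (ENNReal.toReal_lt_toReal (measure_ne_top _ _) (measure_ne_top _ _)).2 h
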